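/- A *2-complex* is a compact Hausdorff space $X$ in which every point $x$ has a closed neighbourhood homeomorphic to the cone over a finite graph $\Gamma_x$, with $x$ corresponding to the cone point. The point $x$ is *generic* if $\Gamma_x$ is homeomorphic to a circle, and a *ridge point* if $\Gamma_x$ is homeomorphic to the graph $\theta_n$ with two vertices and $n\ge 3$ edges connecting them; near a ridge point $X$ looks like $n$ half-planes (the branches) with a common boundary line. Let $\operatorname{Int}(X)$ and $\operatorname{rid}(X)$ be the sets of generic points and of ridge points. A *link* $L$ in $X$ is a non-empty finite family of closed curves $S^1\to X$ with images in $\operatorname{Int}(X)\cup\operatorname{rid}(X)$, such that the crossings of the curves with themselves and with each other are finitely many double transversal crossings lying in $\operatorname{Int}(X)$, and such that near each ridge point on it a curve is an embedded arc which lies in the union of two different branches and meets $\operatorname{rid}(X)$ transversally; moreover, at every crossing two opposite ones of the four adjacent areas are marked with dots. Let $\#L$ be the set of crossings and $\operatorname{cro}(L)=\operatorname{card}(\#L)$. Two links are *disjoint* if their underlying curves do not meet; a link is *unsplittable* if it is not a union of two non-empty disjoint links. Every link is uniquely a union of disjoint unsplittable links, its *split components*, whose number is $sc(L)$. For $C\subset\#L$,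 smooth $L$ at all crossings so that the two dotted areas get connected at each crossing in $C$ and the two undotted areas get connected at each other crossing; let $|L,C|\ge 1$ be the number of the resulting disjoint simple closed curves. The *bracket polynomial* of $L$ is $$\langle L\rangle=\sum_{C\subset\#L}(-A^2-A^{-2})^{|L,C|-1}A^{2\operatorname{card}(C)-\operatorname{cro}(L)}\in\mathbb Z[A,A^{-1}].$$ The *span* $\operatorname{span}(f)$ of a non-zero Laurent polynomial $f$ is its top degree minus its low degree, and $\operatorname{span}(0)=0$. **Theorem.** For any link $L$ in a 2-complex $X$, $$\operatorname{cro}(L)\ \ge\ 1-sc(L)+\frac{\operatorname{span}(\langle L\rangle)}4 .$$ In particular, $\operatorname{cro}(L)\ge\operatorname{span}(\langle L\rangle)/4$ for any unsplittable link $L$ in $X$. -/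

import Mathlib

open Set Filter Topology
open scoped LaurentPolynomial

noncomputable section

/-! ### Graphs, cones, 2-complexes -/

/-- A finite graph: finitely many vertices and edges; loops and multiple edges are allowed. -/
structure FinGraph where
  nV : ℕ
  nE : ℕ
  src : Fin nE → Fin nV
  tgt : Fin nE → Fin nV

namespace FinGraph

/-- The gluing of the ends of the edges `e × [0,1]` to the vertices. -/
inductive Glue (G : FinGraph) :
    Fin G.nV ⊕ (Fin G.nE × unitInterval) → Fin G.nV ⊕ (Fin G.nE × unitInterval) → Prop
  | src (e : Fin G.nE) : Glue G (Sum.inr (e, 0)) (Sum.inl (G.src e))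
  | tgt (e : Fin G.nE) : Glue G (Sum.inr (e, 1)) (Sum.inl (G.tgt e))

/-- The underlying topological space of a finite graph, with the quotient topology. -/
abbrev Space (G : FinGraph) : Type := Quot G.Glue

/-- The graph `θ_n`: two vertices and `n` edges connecting them. -/
def theta (n : ℕ) : FinGraph where
  nV := 2
  nE := n
  src := fun _ => 0
  tgt := fun _ => 1

end FinGraph

/-- The gluing of `Γ × {0}` to the cone point. -/
inductive ConeGlue (Γ : Type) : Unit ⊕ (Γ × unitInterval) → Unit ⊕ (Γ × unitInterval) → Prop
  | apex (g : Γ) : ConeGlue Γ (Sum.inr (g, 0)) (Sum.inl ())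

/-- The cone over `Γ` (the cone over the empty space is a point). -/
abbrev TopCone (Γ : Type) : Type := Quot (ConeGlue Γ)

/-- The cone point. -/
def TopCone.apex (Γ : Type) : TopCone Γ := Quot.mk _ (Sum.inl ())

/-- `x` has a closed neighbourhood homeomorphic to the cone over `G`, with `x` at the cone point. -/
def HasConeNhd {X : Type*} [TopologicalSpace X] (x : X) (G : FinGraph) : Prop :=
  ∃ e : TopCone G.Space → X, IsClosedEmbedding e ∧ e (TopCone.apex G.Space) = x ∧ range e ∈ 𝓝 x

/-- 2-complexes: compact Hausdorff spaces that are locally cones over finite graphs. -/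
structure IsTwoComplex (X : Type*) [TopologicalSpace X] : Prop where
  compact : CompactSpace X
  hausdorff : T2Space X
  cone : ∀ x : X, ∃ G : FinGraph, HasConeNhd x G

/-- `Int(X)`, the set of generic points: the graph at the point is homeomorphic to a circle. -/
def genericPts (X : Type*) [TopologicalSpace X] : Set X :=
  {x | ∃ G : FinGraph, Nonempty (G.Space ≃ₜ Circle) ∧ HasConeNhd x G}

/-- `rid(X)`, the set of ridge points: the graph at the point is homeomorphic to `θ_n`, `n ≥ 3`. -/
def ridgePts (X : Type*) [TopologicalSpace X] : Set X :=
  {x | ∃ n : ℕ, 3 ≤ n ∧ ∃ G : FinGraph,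
    Nonempty (G.Space ≃ₜ (FinGraph.theta n).Space) ∧ HasConeNhd x G}

/-- The union of `n` half-planes `{(v, s) | v = t • e_k, t ≥ 0}`, `k < n`, with the common boundary
line `v = 0`. -/
abbrev OpenBook (n : ℕ) : Type :=
  {p : (Fin n → ℝ) × ℝ // (∀ i, 0 ≤ p.1 i) ∧ ∀ i j, i ≠ j → p.1 i = 0 ∨ p.1 j = 0}

/-- The point of the boundary line of all pages with coordinate `0`. -/
def OpenBook.origin (n : ℕ) : OpenBook n := ⟨0, fun _ => le_rfl, fun _ _ _ => Or.inl rfl⟩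

/-! ### Generic families of closed curves -/

section Curves

variable {X : Type*} [TopologicalSpace X] {n : ℕ}

/-- The map from the disjoint union of `n` circles given by a family of `n` closed curves. -/
def totalMap (γ : Fin n → C(Circle, X)) : (Σ _ : Fin n, Circle) → X := fun p => γ p.1 p.2

/-- The crossings (of the curves with themselves and with each other): points passed at least
twice. -/
def crossingSet (γ : Fin n → C(Circle, X)) : Set X :=
  {x | ∃ p q : Σ _ : Fin n, Circle, p ≠ q ∧ totalMap γ p = x ∧ totalMap γ q = x}

/-- A planar chart at `c` in which the union of the curves is the union of the two coordinate axes,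
one branch running along the first axis and another one along the second axis: thus two branches
cross transversally at `c`. The four areas adjacent to `c` are the four open quadrants. -/
structure CrossingChart (γ : Fin n → C(Circle, X)) (c : X) where
  toFun : ℝ × ℝ → X
  isOpenEmbedding : IsOpenEmbedding toFun
  map_zero : toFun (0, 0) = c
  preimage_eq : toFun ⁻¹' range (totalMap γ) = {p | p.1 = 0 ∨ p.2 = 0}
  transversal : ∃ a b : Σ _ : Fin n, Circle, a ≠ b ∧ totalMap γ a = c ∧ totalMap γ b = c ∧
    (∀ᶠ t in 𝓝 a, totalMap γ t ∈ toFun '' {p | p.2 = 0}) ∧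
    (∀ᶠ t in 𝓝 b, totalMap γ t ∈ toFun '' {p | p.1 = 0})

/-- Near the ridge point `x` the set `ℓ` is an arc which lies in the union of two different branches
of `X` at `x` (the pages `k` and `l`) and which crosses the ridge transversally at `x`. -/
def CrossesRidgeAt (ℓ : Set X) (x : X) : Prop :=
  ∃ (m : ℕ) (_ : 3 ≤ m) (ψ : OpenBook m → X) (k l : Fin m),
    IsOpenEmbedding ψ ∧ ψ (OpenBook.origin m) = x ∧ k ≠ l ∧
    ψ ⁻¹' ℓ = {p | p.1.2 = 0 ∧ ∀ j, j ≠ k → j ≠ l → p.1.1 j = 0}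

/-- Generic finite families of closed curves. -/
structure IsGenericFamily (γ : Fin n → C(Circle, X)) : Prop where
  mem_int_or_ridge : ∀ i t, γ i t ∈ genericPts X ∪ ridgePts X
  finite_crossings : (crossingSet γ).Finite
  crossings_interior : crossingSet γ ⊆ genericPts X
  double : ∀ c ∈ crossingSet γ, (totalMap γ ⁻¹' {c}).encard = 2
  transversal : ∀ c ∈ crossingSet γ, Nonempty (CrossingChart γ c)
  ridge : ∀ i, ∀ x ∈ ridgePts X, x ∈ range (γ i) → CrossesRidgeAt (range (γ i)) x

end Curves

/-! ### Links -/

/-- A link in `X`: a non-empty finite generic family of closed curves with, at every crossing, two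
dots in opposite adjacent areas. The dots at `c` are recorded by a small chart at `c`, chosen so that
they lie in the quadrants `x, y > 0` and `x, y < 0`. The charts at different crossings are disjoint.
-/
structure DottedLink (X : Type*) [TopologicalSpace X] where
  n : ℕ
  n_pos : 0 < n
  curve : Fin n → C(Circle, X)
  generic : IsGenericFamily curve
  chart : ∀ c : crossingSet curve, CrossingChart curve c
  chart_disjoint : ∀ c d : crossingSet curve, c ≠ d →
    Disjoint (range (chart c).toFun) (range (chart d).toFun)

namespace DottedLink

variable {X : Type*} [TopologicalSpace X]

/-- The set `#L` of crossings. -/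
def crossings (L : DottedLink X) : Finset X := L.generic.finite_crossings.toFinset

/-- The number of crossings. -/
def cro (L : DottedLink X) : ℕ := L.crossings.card

/-- The union of the underlying loops of the components with index in `S`. -/
def carrier (L : DottedLink X) (S : Set (Fin L.n)) : Set X := ⋃ i ∈ S, range (L.curve i)

/-- The link formed by the components with index in `S` is not a union of two non-empty disjoint
links. -/
def UnsplittableOn (L : DottedLink X) (S : Set (Fin L.n)) : Prop :=
  ¬ ∃ S₁ S₂ : Set (Fin L.n), S₁.Nonempty ∧ S₂.Nonempty ∧ S₁ ∪ S₂ = S ∧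
    Disjoint (L.carrier S₁) (L.carrier S₂)

/-- Unsplittable links. -/
def Unsplittable (L : DottedLink X) : Prop := L.UnsplittableOn univ

/-- Split components: the non-empty unsplittable sublinks that are disjoint from the rest of the
link. -/
def IsSplitComponent (L : DottedLink X) (S : Set (Fin L.n)) : Prop :=
  S.Nonempty ∧ L.UnsplittableOn S ∧ Disjoint (L.carrier S) (L.carrier Sᶜ)

/-- The number of split components. -/
def sc (L : DottedLink X) : ℕ := {S : Set (Fin L.n) | L.IsSplitComponent S}.ncard

open Classical in
/-- The two arcs that replace, in a chart, the two crossing segments of the axes in the square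
`|x| + |y| ≤ 1`. For `positive = True` they lie in the two areas without dots, so that the two
dotted areas get connected; for `positive = False` they lie in the two dotted areas. -/
def smoothingArcs (positive : Prop) : Set (ℝ × ℝ) :=
  if positive then {p | |p.1| + |p.2| = 1 ∧ p.1 * p.2 ≤ 0}
  else {p | |p.1| + |p.2| = 1 ∧ 0 ≤ p.1 * p.2}

/-- The system of disjoint simple closed curves obtained by smoothing `L` at all crossings,
connecting the dotted areas at the crossings in `C` and the undotted areas at the others. -/
def smoothing (L : DottedLink X) (C : Finset X) : Set X :=
  (L.carrier univ \ ⋃ c, (L.chart c).toFun '' {p | |p.1| + |p.2| < 1}) ∪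
    ⋃ c, (L.chart c).toFun '' smoothingArcs ((c : X) ∈ C)

/-- `|L, C|`, the number of closed curves in the smoothed link. -/
def smoothingCount (L : DottedLink X) (C : Finset X) : ℕ :=
  Nat.card (ConnectedComponents (L.smoothing C))

/-- The summand `⟨L, C⟩` of the bracket polynomial; `A = T 1`. -/
def bracketTerm (L : DottedLink X) (C : Finset X) : ℤ[T;T⁻¹] :=
  (-LaurentPolynomial.T 2 - LaurentPolynomial.T (-2)) ^ (L.smoothingCount C - 1) *
    LaurentPolynomial.T (2 * (C.card : ℤ) - (L.cro : ℤ))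

/-- The bracket polynomial `⟨L⟩`. -/
def bracket (L : DottedLink X) : ℤ[T;T⁻¹] := ∑ C ∈ L.crossings.powerset, L.bracketTerm C

end DottedLink

open Classical in
/-- The span of a Laurent polynomial: top degree minus low degree, and `0` for the zero
polynomial. -/
def laurentSpan (f : ℤ[T;T⁻¹]) : ℤ :=
  if h : f.coeff.support.Nonempty then f.coeff.support.max' h - f.coeff.support.min' h else 0

end

/-! The exponents in the summand of a state $C$ differ from
$2\operatorname{card}(C)-\operatorname{cro}(L)$ by at most $2(|L,C|-1)$. Changing the smoothing at
one crossing changes the number of loops by at most one, so the extreme states $\#L$ and $\emptyset$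
bound all exponents, and the span is at most $2\operatorname{cro}(L)+2(|L,\#L|+|L,\emptyset|)-4$
(`laurentSpan_stateSum_le`). It remains to see that
$|L,\#L|+|L,\emptyset|\le\operatorname{cro}(L)+2\,sc(L)$.

The link need not lie on a surface, so linear algebra over `ZMod 2` replaces Euler characteristics
of surfaces. Let $H$ be the space of locally constant functions on the core, which is the link
without open squares around its crossings. The loops of a state are counted by the dimension of the
space of those $h\in H$ that agree at the corners joined by its smoothing arcs
(`smoothingCount_eq_finrank`).

Along each of the two branches through a crossing, $h$ has a jump. In both extreme spaces the two
jumps at a crossing are equal; let $W\subset H$ be defined by this condition. An element of $H$ is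
determined by one value per curve and by its jumps, and the jumps along a closed curve add up to
zero (`sum_jumps_circle_eq_zero`). Hence, in the graph with the curves as vertices and the crossings
as edges, the jumps of $h\in W$ form a cycle modulo 2, and $\dim W\le\operatorname{cro}(L)+e$, where
$e$ is the dimension of the functions on vertices that are constant along edges. A function in both
extreme spaces has no jumps and takes equal values on curves that cross, so these functions have
dimension at most $e$. The dimension formula gives $\operatorname{cro}(L)+2e$
(`finrank_stateSpace_add_le`), and $e\le sc(L)$ (`finrank_edgeConstant_le_sc`). -/

/-- The Laurent polynomials with all exponents in `[a, b]`. -/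
def SupportedIcc (a b : ℤ) (f : ℤ[T;T⁻¹]) : Prop := ∀ m, f.coeff m ≠ 0 → a ≤ m ∧ m ≤ b

/-! ### Exponent ranges of Laurent polynomials -/

namespace SupportedIcc

theorem mono {a b a' b' : ℤ} {f : ℤ[T;T⁻¹]} (h : SupportedIcc a b f) (ha : a' ≤ a) (hb : b ≤ b') :
    SupportedIcc a' b' f := fun m hm => ⟨ha.trans (h m hm).1, (h m hm).2.trans hb⟩

theorem mul_T {a b : ℤ} {f : ℤ[T;T⁻¹]} (h : SupportedIcc a b f) (n : ℤ) :
    SupportedIcc (a + n) (b + n) (f * LaurentPolynomial.T n) := by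
  intro m hm
  have : (f * LaurentPolynomial.T n).coeff m = f.coeff (m - n) := by
    rw [LaurentPolynomial.T, AddMonoidAlgebra.coeff_mul_single_eq_coeff_mul (m - n)
      (fun m' _ => by omega), mul_one]
  rw [this] at hm
  have := h _ hm
  omega

theorem sub {a b : ℤ} {f g : ℤ[T;T⁻¹]} (hf : SupportedIcc a b f) (hg : SupportedIcc a b g) :
    SupportedIcc a b (f - g) := by
  intro m hm
  by_cases h : f.coeff m = 0
  · refine hg m fun h' => hm ?_
    simp [AddMonoidAlgebra.coeff_sub, h, h']
  · exact hf m h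

theorem sum {ι : Type*} {a b : ℤ} (s : Finset ι) (f : ι → ℤ[T;T⁻¹])
    (h : ∀ i ∈ s, SupportedIcc a b (f i)) : SupportedIcc a b (∑ i ∈ s, f i) := by
  intro m hm
  rw [AddMonoidAlgebra.coeff_sum, Finsupp.finsetSum_apply] at hm
  obtain ⟨i, hi, h'⟩ := Finset.exists_ne_zero_of_sum_ne_zero hm
  exact h i hi m h'

theorem loopValue_pow (k : ℕ) : SupportedIcc (-(2 * k)) (2 * k)
    ((-LaurentPolynomial.T 2 - LaurentPolynomial.T (-2) : ℤ[T;T⁻¹]) ^ k) := by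
  induction k with
  | zero =>
    intro m hm
    rw [pow_zero, ← LaurentPolynomial.T_zero, LaurentPolynomial.T_apply] at hm
    have : m = 0 := by by_contra h; exact hm (if_neg (Ne.symm h))
    simp [this]
  | succ k ih =>
    have h0 : SupportedIcc (-(2 * (k + 1))) (2 * (k + 1)) (0 : ℤ[T;T⁻¹]) := by
      intro m hm; simp at hm
    have : (-LaurentPolynomial.T 2 - LaurentPolynomial.T (-2) : ℤ[T;T⁻¹]) ^ (k + 1) =
        0 - (-LaurentPolynomial.T 2 - LaurentPolynomial.T (-2)) ^ k * LaurentPolynomial.T 2 -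
          (-LaurentPolynomial.T 2 - LaurentPolynomial.T (-2)) ^ k * LaurentPolynomial.T (-2) := by
      ring
    rw [this]
    push_cast
    exact (h0.sub ((ih.mul_T 2).mono (by linarith) (by linarith))).sub
      ((ih.mul_T (-2)).mono (by linarith) (by linarith))

theorem laurentSpan_le {a b : ℤ} {f : ℤ[T;T⁻¹]} (h : SupportedIcc a b f) (hab : a ≤ b) :
    laurentSpan f ≤ b - a := by
  unfold laurentSpan
  split_ifs with hf
  · have h1 := (h _ (Finsupp.mem_support_iff.1 (f.coeff.support.max'_mem hf))).2
    have h2 := (h _ (Finsupp.mem_support_iff.1 (f.coeff.support.min'_mem hf))).1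
    omega
  · omega

end SupportedIcc

/-! ### The span of a state sum -/

/-- A function on the subsets of `s` that decreases by at most one when a point is added. -/
theorem add_card_le_of_insert {α : Type*} [DecidableEq α] (s : Finset α) (f : Finset α → ℕ)
    (h : ∀ C c, c ∈ s → C ⊆ s → c ∉ C → f C ≤ f (insert c C) + 1) {C D : Finset α} (hCD : C ⊆ D)
    (hD : D ⊆ s) : f C + C.card ≤ f D + D.card := by
  induction D using Finset.strongInduction with
  | H D ih =>
    rcases eq_or_ne C D with rfl | hne
    · rfl
    · obtain ⟨c, hcD, hcC⟩ := Finset.exists_of_ssubset (hCD.ssubset_of_ne hne)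
      have h1 := ih (D.erase c) (Finset.erase_ssubset hcD) (Finset.subset_erase.2 ⟨hCD, hcC⟩)
        ((Finset.erase_subset _ _).trans hD)
      have h2 := h (D.erase c) c (hD hcD) ((Finset.erase_subset _ _).trans hD)
        (Finset.notMem_erase _ _)
      rw [Finset.insert_erase hcD] at h2
      have := Finset.card_erase_add_one hcD
      omega

theorem sub_card_le_of_insert {α : Type*} [DecidableEq α] (s : Finset α) (f : Finset α → ℕ)
    (h : ∀ C c, c ∈ s → C ⊆ s → c ∉ C → f (insert c C) ≤ f C + 1) {C : Finset α} (hC : C ⊆ s) :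
    f C ≤ f ∅ + C.card := by
  induction C using Finset.induction_on with
  | empty => simp
  | insert c C hc ih =>
    have h1 := ih ((Finset.subset_insert _ _).trans hC)
    have h2 := h C c (hC (Finset.mem_insert_self _ _)) ((Finset.subset_insert _ _).trans hC) hc
    rw [Finset.card_insert_of_notMem hc]
    omega

/-- The span of a state sum, bounded by the numbers of loops in the two extreme states. -/
theorem laurentSpan_stateSum_le {α : Type*} [DecidableEq α] (s : Finset α) (f : Finset α → ℕ)
    (hpos : ∀ C, 1 ≤ f C)
    (h₁ : ∀ C c, c ∈ s → C ⊆ s → c ∉ C → f C ≤ f (insert c C) + 1)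
    (h₂ : ∀ C c, c ∈ s → C ⊆ s → c ∉ C → f (insert c C) ≤ f C + 1) :
    laurentSpan (∑ C ∈ s.powerset, (-LaurentPolynomial.T 2 - LaurentPolynomial.T (-2)) ^ (f C - 1) *
      LaurentPolynomial.T (2 * (C.card : ℤ) - (s.card : ℤ))) ≤
      2 * s.card + 2 * f s + 2 * f ∅ - 4 := by
  -- The top exponent of a summand is `2 * (f C - 1) + 2 * C.card - s.card`, bounded by `e1`, which
  -- compares `C` with `s`. The bottom one is bounded by `e2`, which compares `C` with `∅`.
  -- Positivity of `f` makes the truncated subtraction harmless.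
  have key : SupportedIcc (-(2 * (f ∅ : ℤ) - 2 + s.card)) (2 * (f s : ℤ) - 2 + s.card)
      (∑ C ∈ s.powerset, (-LaurentPolynomial.T 2 - LaurentPolynomial.T (-2)) ^ (f C - 1) *
      LaurentPolynomial.T (2 * (C.card : ℤ) - (s.card : ℤ))) := by
    refine SupportedIcc.sum _ _ fun C hC => ?_
    have hCs := Finset.mem_powerset.1 hC
    have e1 := add_card_le_of_insert s f h₁ hCs subset_rfl
    have e2 := sub_card_le_of_insert s f h₂ hCs
    have e3 := hpos C
    refine ((SupportedIcc.loopValue_pow (f C - 1)).mul_T _).mono ?_ ?_ <;> omega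
  have := hpos s
  have := hpos ∅
  exact (key.laurentSpan_le (by omega)).trans (by omega)

/-! ### Counting components by locally constant functions -/

section LocallyConstant

variable {S : Type*} [TopologicalSpace S]

/-- Infinitely many components would give arbitrarily many disjoint non-empty clopen sets, and these
have distinct characteristic functions. -/
theorem finite_connectedComponents_of_finite_locallyConstant
    [Finite (LocallyConstant S (ZMod 2))] : Finite (ConnectedComponents S) := by
  by_contra hinf
  rw [not_finite_iff_infinite] at hinf
  obtain ⟨U, h1, h2, h3, -⟩ := ConnectedComponents.exists_fun_isClopen_of_infinite S
    (Nat.card (LocallyConstant S (ZMod 2)) + 1) (Nat.succ_pos _)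
  have hinj : Function.Injective fun i => LocallyConstant.charFn (ZMod 2) (h1 i) := by
    intro i j hij
    by_contra hne
    have hU := LocallyConstant.charFn_inj (Y := ZMod 2) (h1 i) (h1 j) hij
    have := h3 hne
    rw [Function.onFun, hU, disjoint_self] at this
    exact (h2 j).ne_empty this
  have := Nat.card_le_card_of_injective _ hinj
  simp at this

/-- The number of components, as the dimension of the space of locally constant functions. -/
theorem finrank_locallyConstant [Finite (LocallyConstant S (ZMod 2))] :
    Module.finrank (ZMod 2) (LocallyConstant S (ZMod 2)) = Nat.card (ConnectedComponents S) := by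
  have := finite_connectedComponents_of_finite_locallyConstant (S := S)
  have := Fintype.ofFinite (ConnectedComponents S)
  let Φ : (ConnectedComponents S → ZMod 2) →ₗ[ZMod 2] LocallyConstant S (ZMod 2) :=
    { toFun := fun φ => ⟨fun x => φ x, (IsLocallyConstant.of_discrete φ).comp_continuous
        ConnectedComponents.continuous_coe⟩
      map_add' := fun _ _ => rfl
      map_smul' := fun _ _ => rfl }
  have hΦ : Function.Bijective Φ := by
    constructor
    · intro φ ψ h
      funext c
      obtain ⟨x, rfl⟩ := ConnectedComponents.surjective_coe c
      exact congrArg (fun f : LocallyConstant S (ZMod 2) => f x) h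
    · intro f
      refine ⟨f.continuous.connectedComponentsLift, ?_⟩
      ext x
      rfl
  rw [← (LinearEquiv.ofBijective Φ hΦ).finrank_eq, Module.finrank_fintype_fun_eq_card,
    Nat.card_eq_fintype_card]

end LocallyConstant

/-! ### Functions with finitely many jumps -/

/-- A function on a preconnected set that is constant in a punctured neighbourhood of each point. -/
theorem IsPreconnected.exists_eventually_punctured_eq {T Y : Type*} [TopologicalSpace T] [T1Space T]
    [∀ x : T, (𝓝[≠] x).NeBot] [Nonempty Y] {s : Set T} (hs : IsPreconnected s) {F : T → Y}
    (hF : ∀ x ∈ s, ∃ w, ∀ᶠ y in 𝓝[≠] x, F y = w) :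
    ∃ w, ∀ x ∈ s, ∀ᶠ y in 𝓝[≠] x, F y = w := by
  have : ∀ x, ∃ w, x ∈ s → ∀ᶠ y in 𝓝[≠] x, F y = w := by
    intro x
    by_cases hx : x ∈ s
    · obtain ⟨w, hw⟩ := hF x hx
      exact ⟨w, fun _ => hw⟩
    · exact ⟨Classical.arbitrary Y, fun h => absurd h hx⟩
  choose w hw using this
  let _ : TopologicalSpace Y := ⊥
  have : DiscreteTopology Y := ⟨rfl⟩
  -- The punctured limit `w` is locally constant: a punctured neighbourhood of `x` is a
  -- neighbourhood of each nearby `x' ≠ x`, so the limits at `x'` and `x` agree.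
  have hcont : ContinuousOn w s := by
    intro x hx
    have h1 : ∀ᶠ x' in 𝓝[≠] x, x' ∈ s → w x' = w x := by
      filter_upwards [eventually_eventually_nhdsWithin.2 (hw x hx), self_mem_nhdsWithin]
        with x' h' hne hx's
      have h2 : ∀ᶠ y in 𝓝[≠] x', F y = w x := by
        have h3 : ∀ᶠ y in 𝓝 x', y ≠ x := isOpen_compl_singleton.mem_nhds hne
        have h' : ∀ᶠ y in 𝓝 x', F y = w x := by
          rwa [(isOpen_compl_singleton (x := x)).nhdsWithin_eq hne] at h'
        exact nhdsWithin_le_nhds h'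
      obtain ⟨y, e1, e2⟩ := ((hw x' hx's).and h2).exists
      exact e1.symm.trans e2
    have h4 : ∀ᶠ x' in 𝓝[s] x, w x' = w x := by
      rw [eventually_nhdsWithin_iff] at h1 ⊢
      filter_upwards [h1] with x' h' hx'
      by_cases hxx : x' = x
      · rw [hxx]
      · exact h' hxx hx'
    exact tendsto_nhds_of_eventually_eq h4
  rcases s.eq_empty_or_nonempty with rfl | ⟨x₀, hx₀⟩
  · exact ⟨Classical.arbitrary Y, by simp⟩
  · exact ⟨w x₀, fun x hx => (hs.constant hcont hx₀ hx) ▸ hw x hx⟩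

/-- One-sided limits of a step at `a`: from the left the comparison with `x` stays strict, whereas
from the right the step at `a = x` is already included. -/
theorem eventually_nhdsLT_ite_lt {M : Type*} [Zero M] (a x : ℝ) (m : M) :
    ∀ᶠ y in 𝓝[<] x, (if a < y then m else 0) = if a < x then m else 0 := by
  by_cases h : a < x
  · filter_upwards [nhdsWithin_le_nhds (lt_mem_nhds h)] with y hy
    rw [if_pos hy, if_pos h]
  · filter_upwards [self_mem_nhdsWithin] with y hy
    rw [if_neg h, if_neg]
    exact fun h' => h (h'.trans hy)

theorem eventually_nhdsGT_ite_lt {M : Type*} [Zero M] (a x : ℝ) (m : M) :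
    ∀ᶠ y in 𝓝[>] x, (if a < y then m else 0) = if a ≤ x then m else 0 := by
  by_cases h : a ≤ x
  · filter_upwards [self_mem_nhdsWithin] with y hy
    rw [if_pos (lt_of_le_of_lt h hy), if_pos h]
  · filter_upwards [nhdsWithin_le_nhds (gt_mem_nhds (not_le.1 h))] with y hy
    rw [if_neg h, if_neg (not_lt.2 hy.le)]

theorem eventually_nhds_ite_lt {M : Type*} [Zero M] (a x : ℝ) (m : M) (h : a ≠ x) :
    ∀ᶠ y in 𝓝 x, (if a < y then m else 0) = if a < x then m else 0 := by
  rcases lt_or_gt_of_ne h with h | h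
  · filter_upwards [lt_mem_nhds h] with y hy
    rw [if_pos hy, if_pos h]
  · filter_upwards [gt_mem_nhds h] with y hy
    rw [if_neg (not_lt.2 hy.le), if_neg (not_lt.2 h.le)]

theorem eventually_sum_eq {ι M T : Type*} [Fintype ι] [AddCommMonoid M] {l : Filter T}
    {f : ι → T → M} {m : ι → M} (h : ∀ i, ∀ᶠ y in l, f i y = m i) :
    ∀ᶠ y in l, ∑ i, f i y = ∑ i, m i := by
  filter_upwards [eventually_all.2 h] with y hy
  exact Finset.sum_congr rfl fun i _ => hy i

theorem add_self_zmod_two (u : ZMod 2) : u + u = 0 := CharTwo.add_self_eq_zero u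

instance infinite_circle : Infinite Circle := Circle.argEquiv.infinite_iff.2
  (Set.Ioc_infinite (by linarith [Real.pi_pos])).to_subtype

/-- A function on the circle with finitely many jumps: the jumps add up to zero. -/
theorem sum_jumps_circle_eq_zero {ι : Type*} [Fintype ι] (q : ι → Circle)
    (hq : Function.Injective q) (g : Circle → ZMod 2) (J : ι → ZMod 2)
    (h₀ : ∀ t, t ∉ range q → ∀ᶠ t' in 𝓝 t, g t' = g t)
    (hJ : ∀ k s, Circle.exp s = q k → ∃ u v, J k = u + v ∧
      (∀ᶠ s' in 𝓝[<] s, g (Circle.exp s') = u) ∧ (∀ᶠ s' in 𝓝[>] s, g (Circle.exp s') = v)) :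
    ∑ k, J k = 0 := by
  classical
  -- The circle is cut open at a point without a jump, so that each jump has a unique parameter
  -- inside one period.
  obtain ⟨t₀, ht₀⟩ := (Set.finite_range q).exists_notMem
  obtain ⟨s₀, rfl⟩ := Circle.exp_surjective t₀
  have hex : ∀ k, ∃ s ∈ Ioo s₀ (s₀ + 2 * Real.pi), Circle.exp s = q k := by
    intro k
    obtain ⟨x, hx⟩ := Circle.exp_surjective (q k)
    obtain ⟨y, hy, hxy⟩ := Circle.periodic_exp.exists_mem_Ico (by positivity) x s₀
    refine ⟨y, ⟨lt_of_le_of_ne hy.1 ?_, hy.2⟩, by rw [← hxy, hx]⟩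
    rintro rfl
    exact ht₀ ⟨k, by rw [← hx, hxy]⟩
  choose s hs hsq using hex
  have hsinj : Function.Injective s := fun j k h => hq (by rw [← hsq, ← hsq, h])
  have hpi := Real.pi_pos
  -- Adding the jumps already passed cancels the discontinuities of `g`, so `F` has the same
  -- punctured limit everywhere on the period.
  set F : ℝ → ZMod 2 := fun x => g (Circle.exp x) + ∑ k, if s k < x then J k else 0 with hFdef
  have hreg : ∀ x, Circle.exp x ∉ range q → (∀ k, s k ≠ x) →
      ∀ᶠ y in 𝓝 x, F y = g (Circle.exp x) + ∑ k, if s k < x then J k else 0 := by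
    intro x hx hk
    filter_upwards [Circle.exp.continuous.continuousAt.eventually (h₀ _ hx),
      eventually_sum_eq fun k => eventually_nhds_ite_lt (s k) x (J k) (hk k)] with y h1 h2
    simp only [hFdef]
    rw [h1, h2]
  have hends : Circle.exp (s₀ + 2 * Real.pi) = Circle.exp s₀ := Circle.periodic_exp s₀
  have hF : ∀ x ∈ Icc s₀ (s₀ + 2 * Real.pi), ∃ w, ∀ᶠ y in 𝓝[≠] x, F y = w := by
    intro x hx
    by_cases hxq : Circle.exp x ∈ range q
    · obtain ⟨k, hk⟩ := hxq
      have hxk : s k = x := by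
        refine Circle.exp_injOn_Ico (a := s₀) (b := s₀ + 2 * Real.pi) (by linarith)
          ⟨(hs k).1.le, (hs k).2⟩ ⟨hx.1, lt_of_le_of_ne hx.2 ?_⟩ ((hsq k).trans hk)
        rintro rfl
        exact ht₀ ⟨k, by rw [hk, hends]⟩
      obtain ⟨u, v, huv, hu, hv⟩ := hJ k x hk.symm
      refine ⟨u + ∑ j, if s j < x then J j else 0, ?_⟩
      rw [← nhdsLT_sup_nhdsGT, eventually_sup]
      constructor
      · filter_upwards [hu, eventually_sum_eq fun j => eventually_nhdsLT_ite_lt (s j) x (J j)]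
          with y h1 h2
        simp only [hFdef]
        rw [h1, h2]
      · filter_upwards [hv, eventually_sum_eq fun j => eventually_nhdsGT_ite_lt (s j) x (J j)]
          with y h1 h2
        simp only [hFdef]
        rw [h1, h2]
        have : ∀ j, (if s j ≤ x then J j else 0) =
            (if s j < x then J j else 0) + if j = k then J k else 0 := by
          intro j
          by_cases hjk : j = k
          · subst hjk; simp [hxk]
          · have : s j ≠ x := fun h => hjk (hsinj (h.trans hxk.symm))
            simp [hjk, le_iff_lt_or_eq, this]
        simp only [this, Finset.sum_add_distrib, Finset.sum_ite_eq', Finset.mem_univ, if_true, huv]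
        -- On the right of the jump, `g` contributes `v` and the new summand `u + v`; together this
        -- is the left value `u`.
        linear_combination add_self_zmod_two v
    · exact ⟨_, nhdsWithin_le_nhds (hreg x hxq fun k h => hxq ⟨k, by rw [← hsq, h]⟩)⟩
  obtain ⟨w, hw⟩ := isPreconnected_Icc.exists_eventually_punctured_eq hF
  have hval : ∀ x ∈ Icc s₀ (s₀ + 2 * Real.pi), Circle.exp x = Circle.exp s₀ →
      g (Circle.exp s₀) + (∑ k, if s k < x then J k else 0) = w := by
    intro x hx hxs
    have hxq : Circle.exp x ∉ range q := by rwa [hxs]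
    have h1 : ∀ᶠ y in 𝓝[≠] x, F y = _ := nhdsWithin_le_nhds
      (hreg x hxq fun k h => hxq ⟨k, by rw [← hsq, h]⟩)
    obtain ⟨y, e1, e2⟩ := (h1.and (hw x hx)).exists
    rw [← e2, e1, hxs]
  -- At the two ends of the period `g` is the same, and the accumulated sum is zero at one end and
  -- the total jump at the other.
  have e1 := hval s₀ ⟨le_rfl, by linarith⟩ rfl
  have e2 := hval (s₀ + 2 * Real.pi) ⟨by linarith, le_rfl⟩ hends
  have e3 : ∀ k, (if s k < s₀ then J k else 0) = 0 := fun k => if_neg (not_lt.2 (hs k).1.le)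
  have e4 : ∀ k, (if s k < s₀ + 2 * Real.pi then J k else 0) = J k := fun k => if_pos (hs k).2
  simp only [e3, Finset.sum_const_zero] at e1
  simp only [e4] at e2
  linear_combination e2 - e1

/-! ### Linear algebra of states over the field with two elements -/

section LinearAlgebra

open Module

variable {H K I : Type*} [AddCommGroup H] [Module (ZMod 2) H]

/-- The elements whose values at the four corners of each crossing agree according to the
smoothing given by `χ`. -/
def stateSpace (ev : K → Bool → Bool → H →ₗ[ZMod 2] ZMod 2) (χ : K → Bool) :
    Submodule (ZMod 2) H where
  carrier := {h | ∀ c s, ev c false s h = ev c true (s ^^ χ c) h}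
  add_mem' := fun ha hb c s => by simp [ha c s, hb c s]
  zero_mem' := by simp
  smul_mem' := fun r x hx c s => by simp [hx c s]

theorem mem_stateSpace {ev : K → Bool → Bool → H →ₗ[ZMod 2] ZMod 2} {χ : K → Bool} {h : H} :
    h ∈ stateSpace ev χ ↔ ∀ c s, ev c false s h = ev c true (s ^^ χ c) h := Iff.rfl

theorem finrank_le_finrank_inf_ker [FiniteDimensional (ZMod 2) H] (V : Submodule (ZMod 2) H)
    (f : H →ₗ[ZMod 2] ZMod 2) :
    finrank (ZMod 2) V ≤ finrank (ZMod 2) (V ⊓ LinearMap.ker f : Submodule (ZMod 2) H) + 1 := by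
  have h1 := Submodule.finrank_sup_add_finrank_inf_eq V (LinearMap.ker f)
  have h2 := Submodule.finrank_le (V ⊔ LinearMap.ker f)
  have h3 := f.finrank_range_add_finrank_ker
  have h4 := Submodule.finrank_le (LinearMap.range f)
  rw [finrank_self] at h4
  omega

/-- Changing the smoothing at one crossing changes the number of loops by at most one. -/
theorem finrank_stateSpace_le_of_eq_off [FiniteDimensional (ZMod 2) H]
    (ev : K → Bool → Bool → H →ₗ[ZMod 2] ZMod 2) {χ χ' : K → Bool} (c : K)
    (h : ∀ d, d ≠ c → χ d = χ' d) :
    finrank (ZMod 2) (stateSpace ev χ) ≤ finrank (ZMod 2) (stateSpace ev χ') + 1 := by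
  -- One linear condition, equality of the two first-axis ends at `c`, makes all four corner values
  -- at `c` equal, so any smoothing there is allowed.
  refine (finrank_le_finrank_inf_ker _ (ev c false true - ev c false false)).trans
    (Nat.add_le_add_right (Submodule.finrank_mono ?_) 1)
  rintro x ⟨hx, hx'⟩
  have hx'' : ev c false true x = ev c false false x := by
    simpa [sub_eq_zero] using hx'
  rw [SetLike.mem_coe, mem_stateSpace] at hx
  rw [mem_stateSpace]
  intro d s
  by_cases hd : d = c
  · subst hd
    have e1 := hx d true
    have e2 := hx d false
    cases s <;> cases h1 : χ d <;> cases h2 : χ' d <;> simp_all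
  · rw [hx d s, h d hd]

variable [DecidableEq I]

/-- The incidence matrix modulo 2 of the graph with vertices `I` and an edge from `p c false` to
`p c true` for every `c`. -/
def incidence (p : K → Bool → I) : Matrix K I (ZMod 2) :=
  fun c i => (if p c false = i then 1 else 0) + if p c true = i then 1 else 0

variable [Fintype I]

theorem incidence_mulVec (p : K → Bool → I) (φ : I → ZMod 2) (c : K) :
    (incidence p).mulVec φ c = φ (p c false) + φ (p c true) := by
  simp [Matrix.mulVec, dotProduct, incidence, add_mul, Finset.sum_add_distrib]

/-- The functions on the vertices that are constant along the edges. -/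
def edgeConstant (p : K → Bool → I) : Submodule (ZMod 2) (I → ZMod 2) :=
  LinearMap.ker (incidence p).mulVecLin

theorem mem_edgeConstant {p : K → Bool → I} {φ : I → ZMod 2} :
    φ ∈ edgeConstant p ↔ ∀ c, φ (p c false) = φ (p c true) := by
  rw [edgeConstant, LinearMap.mem_ker, funext_iff]
  refine forall_congr' fun c => ?_
  rw [Matrix.mulVecLin_apply, incidence_mulVec]
  exact CharTwo.add_eq_zero

variable [Fintype K]

/-- The Euler characteristic of a graph: the first kernel is its cycle space, and the formula is
rank–nullity for a matrix and its transpose, which have equal rank. -/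
theorem finrank_ker_incidence_transpose [DecidableEq K] (p : K → Bool → I) :
    finrank (ZMod 2) (LinearMap.ker (incidence p).transpose.mulVecLin) + Fintype.card I =
      Fintype.card K + finrank (ZMod 2) (edgeConstant p) := by
  have h1 := (incidence p).mulVecLin.finrank_range_add_finrank_ker
  have h2 := (incidence p).transpose.mulVecLin.finrank_range_add_finrank_ker
  have h3 := (incidence p).rank_transpose
  rw [Matrix.rank, Matrix.rank] at h3
  rw [finrank_fintype_fun_eq_card] at h1 h2
  rw [edgeConstant]
  omega

/-- The dual state lemma. -/
theorem finrank_stateSpace_add_le [FiniteDimensional (ZMod 2) H]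
    (ev : K → Bool → Bool → H →ₗ[ZMod 2] ZMod 2) (p : K → Bool → I)
    (base : I → H →ₗ[ZMod 2] ZMod 2)
    (hinj : ∀ h, (∀ i, base i h = 0) → (∀ c a, ev c a true h + ev c a false h = 0) → h = 0)
    (hjump : ∀ i h, ∑ x : K × Bool,
      (if p x.1 x.2 = i then ev x.1 x.2 true h + ev x.1 x.2 false h else 0) = 0)
    (hconst : ∀ h, (∀ c a, ev c a true h + ev c a false h = 0) →
      ∀ c a, ev c a true h = base (p c a) h) :
    finrank (ZMod 2) (stateSpace ev fun _ => true) +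
      finrank (ZMod 2) (stateSpace ev fun _ => false) ≤
      Fintype.card K + 2 * finrank (ZMod 2) (edgeConstant p) := by
  classical
  set V₁ := stateSpace ev fun _ => true
  set V₀ := stateSpace ev fun _ => false
  let J : H →ₗ[ZMod 2] (K → ZMod 2) :=
    LinearMap.pi fun c => ev c false true + ev c false false
  let J' : H →ₗ[ZMod 2] (K → ZMod 2) :=
    LinearMap.pi fun c => ev c true true + ev c true false
  -- `J` and `J'` are the jumps along the two branches; either uniform smoothing pairs the ends of
  -- one branch with those of the other and so forces `J = J'`.
  let W : Submodule (ZMod 2) H := LinearMap.ker (J - J')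
  have memW : ∀ {h}, h ∈ W ↔ ∀ c, ev c false true h + ev c false false h =
      ev c true true h + ev c true false h := by
    intro h
    rw [LinearMap.mem_ker, LinearMap.sub_apply, sub_eq_zero, funext_iff]
    rfl
  have hV₁ : V₁ ≤ W := fun h hh => memW.2 fun c => by
    rw [hh c true, hh c false]; simp [add_comm]
  have hV₀ : V₀ ≤ W := fun h hh => memW.2 fun c => by
    rw [hh c true, hh c false]; simp
  have hW : finrank (ZMod 2) W ≤ Fintype.card I +
      finrank (ZMod 2) (LinearMap.ker (incidence p).transpose.mulVecLin) := by
    -- On `W` a single jump per crossing serves both branches, so the vanishing of the jump sum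
    -- along curve `i` is exactly the cycle condition at vertex `i`.
    have hJ : ∀ h ∈ W, J h ∈ LinearMap.ker (incidence p).transpose.mulVecLin := by
      intro h hh
      rw [LinearMap.mem_ker]
      funext i
      rw [Matrix.mulVecLin_apply, Matrix.mulVec, dotProduct, Pi.zero_apply, ← hjump i h,
        Fintype.sum_prod_type]
      refine Finset.sum_congr rfl fun c _ => ?_
      have := memW.1 hh c
      have hJc : J h c = ev c false true h + ev c false false h := rfl
      rw [Fintype.sum_bool, hJc]
      simp only [Matrix.transpose_apply, incidence, add_mul, ite_mul, one_mul, zero_mul]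
      rw [← this, add_comm]
    let Φ : W →ₗ[ZMod 2] (I → ZMod 2) × LinearMap.ker (incidence p).transpose.mulVecLin :=
      ((LinearMap.pi base).comp W.subtype).prod
        ((J.comp W.subtype).codRestrict _ fun h => hJ h h.2)
    have hΦ : Function.Injective Φ := by
      rw [← LinearMap.ker_eq_bot, LinearMap.ker_eq_bot']
      rintro ⟨h, hh⟩ h0
      have h1 : ∀ i, base i h = 0 := fun i => congrFun (congrArg Prod.fst h0) i
      have h2 : ∀ c, ev c false true h + ev c false false h = 0 := fun c =>
        congrFun (congrArg Subtype.val (congrArg Prod.snd h0)) c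
      have : h = 0 := hinj h h1 fun c a => by
        cases a
        · exact h2 c
        · rw [← memW.1 hh c]; exact h2 c
      exact Subtype.ext this
    have := LinearMap.finrank_le_finrank_of_injective hΦ
    rwa [finrank_prod, finrank_fintype_fun_eq_card] at this
  have hinf : finrank (ZMod 2) (V₁ ⊓ V₀ : Submodule (ZMod 2) H) ≤
      finrank (ZMod 2) (edgeConstant p) := by
    -- The two smoothings together identify all four ends at a crossing.
    have hall : ∀ h ∈ V₁ ⊓ V₀, (∀ c a, ev c a true h + ev c a false h = 0) ∧
        ∀ c, ev c false true h = ev c true true h := by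
      rintro h ⟨h1, h0⟩
      have e1 := fun c => h1 c true
      have e2 := fun c => h1 c false
      have e3 := fun c => h0 c true
      have e4 := fun c => h0 c false
      simp only [Bool.xor_true, Bool.xor_false, Bool.not_true, Bool.not_false] at e1 e2 e3 e4
      refine ⟨fun c a => ?_, e3⟩
      rw [CharTwo.add_eq_zero]
      cases a
      · rw [e1, e4]
      · rw [← e2, e4]
    let Ψ : (V₁ ⊓ V₀ : Submodule (ZMod 2) H) →ₗ[ZMod 2] edgeConstant p :=
      ((LinearMap.pi base).comp (Submodule.subtype _)).codRestrict _ fun h => by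
        rw [mem_edgeConstant]
        intro c
        obtain ⟨e1, e2⟩ := hall h h.2
        have := hconst h e1
        exact ((this c false).symm.trans (e2 c)).trans (this c true)
    have hΨ : Function.Injective Ψ := by
      rw [← LinearMap.ker_eq_bot, LinearMap.ker_eq_bot']
      rintro ⟨h, hh⟩ h0
      have h1 : ∀ i, base i h = 0 := fun i => congrFun (congrArg Subtype.val h0) i
      exact Subtype.ext (hinj h h1 (hall h hh).1)
    exact LinearMap.finrank_le_finrank_of_injective hΨ
  have h1 := Submodule.finrank_sup_add_finrank_inf_eq V₁ V₀
  have h2 := Submodule.finrank_mono (sup_le hV₁ hV₀)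
  have h3 := finrank_ker_incidence_transpose p
  omega

end LinearAlgebra

noncomputable section

/-! ### The cross in the plane -/

namespace Cross

/-- The sign of a boolean. -/
def sgn (s : Bool) : ℝ := bif s then 1 else -1

/-- The four unit vectors on the axes. -/
def dir (a s : Bool) : ℝ × ℝ := bif a then (0, sgn s) else (sgn s, 0)

/-- The first axis (`a = false`) or the second axis (`a = true`). -/
def axis (a : Bool) : Set (ℝ × ℝ) := bif a then {p | p.1 = 0} else {p | p.2 = 0}

/-- The coordinate along an axis. -/
def coord (a : Bool) (p : ℝ × ℝ) : ℝ := bif a then p.2 else p.1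

/-- The four open half-axes. -/
def ray (a s : Bool) : Set (ℝ × ℝ) := {p | p ∈ axis a ∧ 0 < sgn s * coord a p}

theorem continuous_coord (a : Bool) : Continuous (coord a) := by
  cases a
  · exact continuous_fst
  · exact continuous_snd

theorem mem_axes_of_mem_axis {a : Bool} {p : ℝ × ℝ} (h : p ∈ axis a) : p.1 = 0 ∨ p.2 = 0 := by
  cases a
  · exact Or.inr h
  · exact Or.inl h

theorem eq_of_coord_eq {a : Bool} {p q : ℝ × ℝ} (hp : p ∈ axis a) (hq : q ∈ axis a)
    (h : coord a p = coord a q) : p = q := by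
  cases a
  · exact Prod.ext h (Eq.trans hp (Eq.symm hq))
  · exact Prod.ext (Eq.trans hp (Eq.symm hq)) h

theorem coord_zero (a : Bool) : coord a (0, 0) = 0 := by cases a <;> rfl

theorem exists_mem_ray_of_mem_axis {a : Bool} {p : ℝ × ℝ} (h : p ∈ axis a) (h0 : p ≠ (0, 0)) :
    ∃ s, p ∈ ray a s := by
  have hc : coord a p ≠ 0 := fun hc => h0 (eq_of_coord_eq (a := a) h (by cases a <;> rfl)
    (hc.trans (coord_zero a).symm))
  rcases lt_or_gt_of_ne hc with h1 | h1
  · exact ⟨false, h, by simp [sgn, h1]⟩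
  · exact ⟨true, h, by simpa [sgn] using h1⟩

theorem exists_mem_ray {p : ℝ × ℝ} (h : p.1 = 0 ∨ p.2 = 0) (h0 : p ≠ (0, 0)) :
    ∃ a s, p ∈ ray a s := by
  rcases h with h | h
  · exact ⟨true, exists_mem_ray_of_mem_axis (a := true) h h0⟩
  · exact ⟨false, exists_mem_ray_of_mem_axis (a := false) h h0⟩

theorem mem_ray_of_pos {a s : Bool} {p : ℝ × ℝ} (h : p.1 = 0 ∨ p.2 = 0)
    (hp : 0 < sgn s * coord a p) : p ∈ ray a s := by
  refine ⟨?_, hp⟩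
  cases a
  · rcases h with h | h
    · simp [coord, h] at hp
    · exact h
  · rcases h with h | h
    · exact h
    · simp [coord, h] at hp

theorem ray_unique {a s a' s' : Bool} {p : ℝ × ℝ} (h : p ∈ ray a s) (h' : p ∈ ray a' s') :
    a = a' ∧ s = s' := by
  obtain ⟨h1, h2⟩ := h
  obtain ⟨h3, h4⟩ := h'
  cases a <;> cases a' <;> cases s <;> cases s' <;>
    simp_all [axis, coord, sgn] <;> linarith

theorem dir_mem_ray (a s : Bool) : dir a s ∈ ray a s := by
  cases a <;> cases s <;> simp [ray, axis, coord, dir, sgn]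

theorem abs_add_abs_dir (a s : Bool) : |(dir a s).1| + |(dir a s).2| = 1 := by
  cases a <;> cases s <;> simp [dir, sgn]

theorem dir_mem_axes (a s : Bool) : (dir a s).1 = 0 ∨ (dir a s).2 = 0 :=
  mem_axes_of_mem_axis (dir_mem_ray a s).1

theorem eq_smul_dir {a s : Bool} {p : ℝ × ℝ} (h : p ∈ ray a s) :
    p = (|p.1| + |p.2|) • dir a s := by
  obtain ⟨h1, h2⟩ := h
  cases a <;> cases s <;> simp only [axis, coord, sgn, cond_true, cond_false, mem_ofPred_eq] at h1 h2
  · have : p.1 < 0 := by linarith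
    ext <;> simp [dir, sgn, h1, abs_of_neg this]
  · have : 0 < p.1 := by linarith
    ext <;> simp [dir, sgn, h1, abs_of_pos this]
  · have : p.2 < 0 := by linarith
    ext <;> simp [dir, sgn, h1, abs_of_neg this]
  · have : 0 < p.2 := by linarith
    ext <;> simp [dir, sgn, h1, abs_of_pos this]

/-- The outer part of a half-axis. -/
def outerRay (a s : Bool) : Set (ℝ × ℝ) := (fun t : ℝ => t • dir a s) '' Ici 1

theorem isPreconnected_outerRay (a s : Bool) : IsPreconnected (outerRay a s) :=
  isPreconnected_Ici.image _ (by fun_prop)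

theorem mem_outerRay {a s : Bool} {p : ℝ × ℝ} (h : p ∈ ray a s) (h1 : 1 ≤ |p.1| + |p.2|) :
    p ∈ outerRay a s := ⟨_, h1, (eq_smul_dir h).symm⟩

theorem dir_mem_outerRay (a s : Bool) : dir a s ∈ outerRay a s := ⟨1, self_mem_Ici, one_smul _ _⟩

theorem of_mem_outerRay {a s : Bool} {p : ℝ × ℝ} (h : p ∈ outerRay a s) :
    (p.1 = 0 ∨ p.2 = 0) ∧ 1 ≤ |p.1| + |p.2| := by
  obtain ⟨t, ht, rfl⟩ := h
  have h1 : |t| = t := abs_of_nonneg (zero_le_one.trans ht)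
  have h2 : (1 : ℝ) ≤ t := ht
  cases a <;> cases s <;> simp [dir, sgn, h1, h2]

/-- The two arcs of a smoothing. -/
def arc (χ s : Bool) : Set (ℝ × ℝ) := segment ℝ (dir false s) (dir true (s ^^ χ))

theorem mem_arc {χ s : Bool} {p : ℝ × ℝ} :
    p ∈ arc χ s ↔ ∃ t ∈ Icc (0 : ℝ) 1, p = (sgn s * (1 - t), sgn (s ^^ χ) * t) := by
  rw [arc, segment_eq_image]
  constructor
  · rintro ⟨t, ht, rfl⟩
    exact ⟨t, ht, by ext <;> simp [dir, mul_comm]⟩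
  · rintro ⟨t, ht, rfl⟩
    exact ⟨t, ht, by ext <;> simp [dir, mul_comm]⟩

theorem abs_add_abs_of_mem_arc {χ s : Bool} {p : ℝ × ℝ} (h : p ∈ arc χ s) :
    |p.1| + |p.2| = 1 := by
  obtain ⟨t, ⟨h0, h1⟩, rfl⟩ := mem_arc.1 h
  have : |1 - t| = 1 - t := abs_of_nonneg (by linarith)
  have h2 : ∀ s, |sgn s| = 1 := fun s => by cases s <;> simp [sgn]
  simp [abs_mul, h2, this, abs_of_nonneg h0]

theorem eq_dir_of_mem_arc {χ s : Bool} {p : ℝ × ℝ} (h : p ∈ arc χ s) (hp : p.1 = 0 ∨ p.2 = 0) :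
    p = dir false s ∨ p = dir true (s ^^ χ) := by
  obtain ⟨t, ⟨h0, h1⟩, rfl⟩ := mem_arc.1 h
  have h2 : ∀ s, sgn s ≠ 0 := fun s => by cases s <;> simp [sgn]
  rcases hp with hp | hp
  · right
    have : 1 - t = 0 := (mul_eq_zero.1 hp).resolve_left (h2 _)
    ext <;> simp [dir, show t = 1 by linarith]
  · left
    have : t = 0 := (mul_eq_zero.1 hp).resolve_left (h2 _)
    ext <;> simp [dir, this]

theorem arc_unique {χ s s' : Bool} {p : ℝ × ℝ} (h : p ∈ arc χ s) (h' : p ∈ arc χ s') : s = s' := by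
  obtain ⟨t, ⟨h0, h1⟩, rfl⟩ := mem_arc.1 h
  obtain ⟨t', ⟨h0', h1'⟩, he⟩ := mem_arc.1 h'
  have e1 := congrArg Prod.fst he
  have e2 := congrArg Prod.snd he
  cases s <;> cases s' <;> cases χ <;> simp_all [sgn] <;> linarith

theorem isPreconnected_arc (χ s : Bool) : IsPreconnected (arc χ s) :=
  (convex_segment _ _).isPreconnected

theorem isCompact_arc (χ s : Bool) : IsCompact (arc χ s) := by
  rw [arc, segment_eq_image]
  exact isCompact_Icc.image (by fun_prop)

theorem dir_false_mem_arc (χ s : Bool) : dir false s ∈ arc χ s := left_mem_segment _ _ _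

theorem dir_true_mem_arc (χ s : Bool) : dir true (s ^^ χ) ∈ arc χ s := right_mem_segment _ _ _

theorem mem_arc_iff {χ s : Bool} {p : ℝ × ℝ} :
    p ∈ arc χ s ↔ |p.1| + |p.2| = 1 ∧ 0 ≤ sgn s * p.1 ∧ 0 ≤ sgn (s ^^ χ) * p.2 := by
  have h2 : ∀ s, sgn s * sgn s = 1 := fun s => by cases s <;> simp [sgn]
  have h3 : ∀ s, |sgn s| = 1 := fun s => by cases s <;> simp [sgn]
  constructor
  · intro h
    refine ⟨abs_add_abs_of_mem_arc h, ?_⟩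
    obtain ⟨t, ⟨h0, h1⟩, rfl⟩ := mem_arc.1 h
    simp only [← mul_assoc, h2, one_mul]
    exact ⟨by linarith, h0⟩
  · rintro ⟨h, hx, hy⟩
    have e1 : |p.1| = sgn s * p.1 := by rw [← abs_of_nonneg hx, abs_mul, h3, one_mul]
    have e2 : |p.2| = sgn (s ^^ χ) * p.2 := by rw [← abs_of_nonneg hy, abs_mul, h3, one_mul]
    refine mem_arc.2 ⟨|p.2|, ⟨abs_nonneg _, by linarith [abs_nonneg p.1]⟩, ?_⟩
    rw [show 1 - |p.2| = |p.1| by linarith, e1, e2, ← mul_assoc, ← mul_assoc, h2, h2]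
    simp

open Classical in
-- A sign condition on the product is a choice of one of two opposite quadrants, indexed by the sign
-- `s` of the first coordinate; connecting the dotted areas corresponds to the twisted pairing.
theorem smoothingArcs_eq (P : Prop) :
    DottedLink.smoothingArcs P = ⋃ s, arc (decide P) s := by
  ext p
  rw [mem_iUnion, Bool.exists_bool, mem_arc_iff, mem_arc_iff, DottedLink.smoothingArcs]
  by_cases hP : P
  · simp only [hP, if_true, mem_ofPred_eq, decide_true, sgn, Bool.xor_true, Bool.not_false,
      Bool.not_true, cond_true, cond_false]
    rw [mul_nonpos_iff]
    constructor
    · rintro ⟨h, h' | h'⟩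
      · exact Or.inr ⟨h, by linarith, by linarith⟩
      · exact Or.inl ⟨h, by linarith, by linarith⟩
    · rintro (⟨h, h1, h2⟩ | ⟨h, h1, h2⟩)
      · exact ⟨h, Or.inr ⟨by linarith, by linarith⟩⟩
      · exact ⟨h, Or.inl ⟨by linarith, by linarith⟩⟩
  · simp only [hP, if_false, mem_ofPred_eq, decide_false, sgn, Bool.xor_false,
      cond_true, cond_false]
    rw [mul_nonneg_iff]
    constructor
    · rintro ⟨h, h' | h'⟩
      · exact Or.inr ⟨h, by linarith, by linarith⟩
      · exact Or.inl ⟨h, by linarith, by linarith⟩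
    · rintro (⟨h, h1, h2⟩ | ⟨h, h1, h2⟩)
      · exact ⟨h, Or.inr ⟨by linarith, by linarith⟩⟩
      · exact ⟨h, Or.inl ⟨by linarith, by linarith⟩⟩

end Cross

end

/-! ### The core of a link and the retraction to it -/

noncomputable section

namespace DottedLink

open Cross

variable {X : Type*} [TopologicalSpace X] (L : DottedLink X)

theorem carrier_univ : L.carrier univ = range (totalMap L.curve) := by
  ext x
  simp [carrier, totalMap, Sigma.exists]

instance finite_crossingSet : Finite (crossingSet L.curve) := L.generic.finite_crossings.to_subtype

theorem chart_injective (c : crossingSet L.curve) : Function.Injective (L.chart c).toFun :=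
  (L.chart c).isOpenEmbedding.injective

theorem chart_mem_carrier_iff {c : crossingSet L.curve} {p : ℝ × ℝ} :
    (L.chart c).toFun p ∈ L.carrier univ ↔ p.1 = 0 ∨ p.2 = 0 := by
  rw [carrier_univ]
  exact Set.ext_iff.1 (L.chart c).preimage_eq p

theorem eq_of_chart_eq_chart {c d : crossingSet L.curve} {p q : ℝ × ℝ}
    (h : (L.chart c).toFun p = (L.chart d).toFun q) : c = d ∧ p = q := by
  have hcd : c = d := by
    by_contra hne
    exact Set.disjoint_left.1 (L.chart_disjoint c d hne) (mem_range_self p) (h ▸ mem_range_self q)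
  subst hcd
  exact ⟨rfl, L.chart_injective c h⟩

/-- The link without the open squares around the crossings. -/
def core : Set X :=
  L.carrier univ \ ⋃ c, (L.chart c).toFun '' {p | |p.1| + |p.2| < 1}

theorem chart_mem_core_iff {c : crossingSet L.curve} {p : ℝ × ℝ} :
    (L.chart c).toFun p ∈ L.core ↔ (p.1 = 0 ∨ p.2 = 0) ∧ 1 ≤ |p.1| + |p.2| := by
  rw [core, Set.mem_sdiff, chart_mem_carrier_iff]
  refine and_congr_right fun _ => ?_
  rw [mem_iUnion, not_exists]
  constructor
  · intro h
    by_contra hlt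
    exact h c ⟨p, not_le.1 hlt, rfl⟩
  · rintro h d ⟨q, hq, he⟩
    obtain ⟨-, rfl⟩ := L.eq_of_chart_eq_chart he
    exact not_lt.2 h hq

theorem core_subset_carrier : L.core ⊆ L.carrier univ := sdiff_subset

/-- The four ends of the core at a crossing. -/
def corner (c : crossingSet L.curve) (a s : Bool) : L.core :=
  ⟨(L.chart c).toFun (dir a s),
    L.chart_mem_core_iff.2 ⟨dir_mem_axes a s, (abs_add_abs_dir a s).ge⟩⟩

/-- The part of the half-axis outside the square is connected, lies in the core and ends at the
corner. -/
theorem apply_eq_corner_of_mem_ray (h : LocallyConstant L.core (ZMod 2)) {c : crossingSet L.curve}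
    {a s : Bool} {p : ℝ × ℝ} (hp : p ∈ ray a s) (hc : (L.chart c).toFun p ∈ L.core) :
    h ⟨_, hc⟩ = h (L.corner c a s) := by
  have hmem : ∀ q : outerRay a s, (L.chart c).toFun q ∈ L.core := fun q =>
    L.chart_mem_core_iff.2 (of_mem_outerRay q.2)
  let f : outerRay a s → L.core := fun q => ⟨(L.chart c).toFun q, hmem q⟩
  have hf : Continuous f :=
    ((L.chart c).isOpenEmbedding.continuous.comp continuous_subtype_val).subtype_mk _
  have : PreconnectedSpace (outerRay a s) :=
    isPreconnected_iff_preconnectedSpace.1 (isPreconnected_outerRay a s)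
  exact (h.isLocallyConstant.comp_continuous hf).apply_eq_of_preconnectedSpace
    ⟨p, mem_outerRay hp (L.chart_mem_core_iff.1 hc).2⟩ ⟨_, dir_mem_outerRay a s⟩

theorem mem_core_or_mem_ray {x : X} (hx : x ∈ L.carrier univ) (hc : x ∉ crossingSet L.curve) :
    x ∈ L.core ∨ ∃ k : crossingSet L.curve × Bool × Bool,
      x ∈ (L.chart k.1).toFun '' ray k.2.1 k.2.2 := by
  by_cases h : x ∈ L.core
  · exact Or.inl h
  · right
    have : x ∈ ⋃ c, (L.chart c).toFun '' {p | |p.1| + |p.2| < 1} := by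
      by_contra h'
      exact h ⟨hx, h'⟩
    obtain ⟨c, p, -, rfl⟩ := mem_iUnion.1 this
    obtain ⟨a, s, hp⟩ := exists_mem_ray (L.chart_mem_carrier_iff.1 hx) (by
      rintro rfl
      rw [(L.chart c).map_zero] at hc
      exact hc c.2)
    exact ⟨(c, a, s), p, hp, rfl⟩

instance nonempty_core : Nonempty L.core := by
  by_cases h : Nonempty (crossingSet L.curve)
  · obtain ⟨c⟩ := h
    exact ⟨L.corner c true true⟩
  · rw [not_nonempty_iff] at h
    refine ⟨L.curve ⟨0, L.n_pos⟩ 1, ?_, ?_⟩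
    · rw [carrier_univ]
      exact ⟨⟨⟨0, L.n_pos⟩, 1⟩, rfl⟩
    · rw [mem_iUnion]
      rintro ⟨c, -⟩
      exact h.elim c

open Classical in
/-- The retraction of the link without the crossings to the core. -/
def retract (x : X) : L.core :=
  if h : x ∈ L.core then ⟨x, h⟩
  else if h : ∃ k : crossingSet L.curve × Bool × Bool,
      x ∈ (L.chart k.1).toFun '' ray k.2.1 k.2.2
    then L.corner h.choose.1 h.choose.2.1 h.choose.2.2
  -- A junk value, taken only at crossings and off the link.
  else Classical.arbitrary _

theorem retract_of_mem_core {x : X} (h : x ∈ L.core) : L.retract x = ⟨x, h⟩ := dif_pos h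

/-- Inside the square the half-axis is collapsed to its corner; the choice of crossing and half-axis
is forced because the charts are disjoint and so are the half-axes. -/
theorem apply_retract_of_mem_ray (h : LocallyConstant L.core (ZMod 2)) {c : crossingSet L.curve}
    {a s : Bool} {x : X} (hx : x ∈ (L.chart c).toFun '' ray a s) :
    h (L.retract x) = h (L.corner c a s) := by
  obtain ⟨p, hp, rfl⟩ := hx
  by_cases hc : (L.chart c).toFun p ∈ L.core
  · rw [retract_of_mem_core L hc, L.apply_eq_corner_of_mem_ray h hp hc]
  · have hex : ∃ k : crossingSet L.curve × Bool × Bool,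
      (L.chart c).toFun p ∈ (L.chart k.1).toFun '' ray k.2.1 k.2.2 := ⟨(c, a, s), p, hp, rfl⟩
    rw [retract, dif_neg hc, dif_pos hex]
    obtain ⟨q, hq, he⟩ := hex.choose_spec
    obtain ⟨h1, rfl⟩ := L.eq_of_chart_eq_chart he
    obtain ⟨h2, h3⟩ := ray_unique hq hp
    rw [h1, h2, h3]

variable [T2Space X]

theorem isCompact_chart_image (c : crossingSet L.curve) {s : Set (ℝ × ℝ)} (hs : IsCompact s) :
    IsClosed ((L.chart c).toFun '' s) :=
  (hs.image (L.chart c).isOpenEmbedding.continuous).isClosed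

theorem isClosed_carrier : IsClosed (L.carrier univ) := by
  rw [carrier_univ]
  have : Continuous (totalMap L.curve) := continuous_sigma fun i => (L.curve i).continuous
  exact (isCompact_range this).isClosed

theorem isClosed_core : IsClosed L.core := by
  refine L.isClosed_carrier.sdiff (isOpen_iUnion fun c => ?_)
  exact (L.chart c).isOpenEmbedding.isOpenMap _ (isOpen_lt (by fun_prop) continuous_const)

theorem isCompact_square : IsCompact {p : ℝ × ℝ | |p.1| + |p.2| ≤ 1} := by
  refine IsCompact.of_isClosed_subset (isCompact_Icc (a := (-1 : ℝ)) (b := 1) |>.prod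
    (isCompact_Icc (a := (-1 : ℝ)) (b := 1))) (isClosed_le (by fun_prop) continuous_const) ?_
  intro p hp
  have hp : |p.1| + |p.2| ≤ 1 := hp
  have h1 := abs_nonneg p.1
  have h2 := abs_nonneg p.2
  exact ⟨abs_le.1 (by linarith), abs_le.1 (by linarith)⟩

/-- Off the crossings, locally constant functions on the core extend to the link. -/
theorem eventually_apply_retract (h : LocallyConstant L.core (ZMod 2)) {x : X}
    (hx : x ∈ L.carrier univ) (hc : x ∉ crossingSet L.curve) :
    ∀ᶠ y in 𝓝[L.carrier univ] x, h (L.retract y) = h (L.retract x) := by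
  by_cases hray : ∃ k : crossingSet L.curve × Bool × Bool,
      x ∈ (L.chart k.1).toFun '' ray k.2.1 k.2.2
  · obtain ⟨⟨c, a, s⟩, hk⟩ := hray
    have hopen : IsOpen ((L.chart c).toFun '' {p | 0 < sgn s * coord a p}) :=
      (L.chart c).isOpenEmbedding.isOpenMap _
        (isOpen_lt continuous_const (continuous_const.mul (continuous_coord a)))
    have hxo : x ∈ (L.chart c).toFun '' {p | 0 < sgn s * coord a p} :=
      image_mono (fun p hp => hp.2) hk
    filter_upwards [nhdsWithin_le_nhds (hopen.mem_nhds hxo), self_mem_nhdsWithin] with y hy hyc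
    obtain ⟨p, hp, rfl⟩ := hy
    rw [L.apply_retract_of_mem_ray h hk, L.apply_retract_of_mem_ray h
      ⟨p, mem_ray_of_pos (L.chart_mem_carrier_iff.1 hyc) hp, rfl⟩]
  · have hxcore := (L.mem_core_or_mem_ray hx hc).resolve_right hray
    -- A point on no half-axis avoids even the closed squares, so near it the link coincides with
    -- the core.
    have hsq : IsClosed (⋃ c, (L.chart c).toFun '' {p | |p.1| + |p.2| ≤ 1}) :=
      isClosed_iUnion_of_finite fun c => L.isCompact_chart_image c isCompact_square
    have hxsq : x ∉ ⋃ c, (L.chart c).toFun '' {p | |p.1| + |p.2| ≤ 1} := by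
      intro h'
      obtain ⟨c, p, -, rfl⟩ := mem_iUnion.1 h'
      obtain ⟨a, s, hp⟩ := exists_mem_ray (L.chart_mem_carrier_iff.1 hx) (by
        rintro rfl
        rw [(L.chart c).map_zero] at hc
        exact hc c.2)
      exact hray ⟨(c, a, s), p, hp, rfl⟩
    have hloc : ∀ᶠ y in 𝓝[L.core] x, h (L.retract y) = h (L.retract x) := by
      rw [nhdsWithin_eq_map_subtype_coe hxcore, eventually_map]
      filter_upwards [(IsLocallyConstant.iff_eventually_eq _).1 h.isLocallyConstant ⟨x, hxcore⟩]
        with y hy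
      rw [L.retract_of_mem_core hxcore, L.retract_of_mem_core y.2]
      exact hy
    filter_upwards [nhdsWithin_le_nhds (hsq.isOpen_compl.mem_nhds hxsq), self_mem_nhdsWithin,
      nhdsWithin_le_nhds (eventually_nhdsWithin_iff.1 hloc)] with y h1 h2 h3
    refine h3 ⟨h2, fun h4 => h1 ?_⟩
    obtain ⟨c, p, hp, rfl⟩ := mem_iUnion.1 h4
    have hp : |p.1| + |p.2| < 1 := hp
    exact mem_iUnion.2 ⟨c, p, hp.le, rfl⟩

end DottedLink

end

noncomputable section

open Module

namespace DottedLink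

open Cross

variable {X : Type*} [TopologicalSpace X] (L : DottedLink X)

/-! ### The passages of the curves through the crossings -/

theorem exists_passage (c : crossingSet L.curve) : ∃ p : Bool → Σ _ : Fin L.n, Circle,
    p false ≠ p true ∧ ∀ a, totalMap L.curve (p a) = c ∧
      ∀ᶠ t in 𝓝 (p a), totalMap L.curve t ∈ (L.chart c).toFun '' axis a := by
  obtain ⟨a, b, hab, ha, hb, ha', hb'⟩ := (L.chart c).transversal
  refine ⟨fun s => bif s then b else a, hab, fun s => ?_⟩
  cases s
  · exact ⟨ha, ha'⟩
  · exact ⟨hb, hb'⟩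

/-- The two passages of the curves through a crossing. -/
def passage (c : crossingSet L.curve) : Bool → Σ _ : Fin L.n, Circle := (L.exists_passage c).choose

theorem passage_ne (c : crossingSet L.curve) (a : Bool) : L.passage c a ≠ L.passage c !a := by
  have := (L.exists_passage c).choose_spec.1
  cases a
  · exact this
  · exact this.symm

theorem totalMap_passage (c : crossingSet L.curve) (a : Bool) :
    totalMap L.curve (L.passage c a) = c := ((L.exists_passage c).choose_spec.2 a).1

theorem eventually_mem_axis (c : crossingSet L.curve) (a : Bool) :
    ∀ᶠ t in 𝓝 (L.passage c a), totalMap L.curve t ∈ (L.chart c).toFun '' axis a :=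
  ((L.exists_passage c).choose_spec.2 a).2

/-- A third parameter would contradict that the crossing is double. -/
theorem exists_eq_passage {c : crossingSet L.curve} {t : Σ _ : Fin L.n, Circle}
    (h : totalMap L.curve t = c) : ∃ a, t = L.passage c a := by
  by_contra! hne
  have h2 := L.generic.double c c.2
  have h3 : ({t, L.passage c false, L.passage c true} : Set (Σ _ : Fin L.n, Circle)).encard ≤
      (totalMap L.curve ⁻¹' {(c : X)}).encard := by
    refine encard_le_encard ?_
    rintro x (rfl | rfl | rfl)
    · exact h
    · exact L.totalMap_passage c _
    · exact L.totalMap_passage c _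
  rw [h2, encard_insert_of_notMem,
    encard_pair (show L.passage c false ≠ L.passage c true from L.passage_ne c false)] at h3
  · exact absurd h3 (by decide)
  · rintro (h' | h')
    · exact hne _ h'
    · exact hne _ h'

theorem passage_injective {c d : crossingSet L.curve} {a b : Bool}
    (h : L.passage c a = L.passage d b) : c = d ∧ a = b := by
  have hcd : c = d := Subtype.ext (by rw [← L.totalMap_passage c a, h, L.totalMap_passage])
  subst hcd
  refine ⟨rfl, ?_⟩
  by_contra hne
  have : b = !a := by cases a <;> cases b <;> simp_all
  exact L.passage_ne c a (this ▸ h)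

theorem mem_crossingSet_iff {t : Σ _ : Fin L.n, Circle} :
    totalMap L.curve t ∈ crossingSet L.curve ↔ ∃ c a, t = L.passage c a := by
  constructor
  · intro h
    obtain ⟨a, ha⟩ := L.exists_eq_passage (c := ⟨_, h⟩) rfl
    exact ⟨_, a, ha⟩
  · rintro ⟨c, a, rfl⟩
    rw [L.totalMap_passage]
    exact c.2

theorem eventually_near_passage (c : crossingSet L.curve) (a : Bool) :
    ∀ᶠ t in 𝓝 (L.passage c a).2, (⟨(L.passage c a).1, t⟩ : Σ _ : Fin L.n, Circle) ≠ L.passage c !a ∧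
      L.curve (L.passage c a).1 t ∈ (L.chart c).toFun '' axis a := by
  have h1 : ∀ᶠ t in 𝓝 (L.passage c a), t ≠ L.passage c !a :=
    isOpen_compl_singleton.mem_nhds (L.passage_ne c a)
  have h2 : Tendsto (fun t => (⟨(L.passage c a).1, t⟩ : Σ _ : Fin L.n, Circle))
      (𝓝 (L.passage c a).2) (𝓝 (L.passage c a)) := continuous_sigmaMk.continuousAt
  exact h2.eventually (h1.and (L.eventually_mem_axis c a))

theorem eventually_punctured_mem_ray (c : crossingSet L.curve) (a : Bool) :
    ∀ᶠ t in 𝓝[≠] (L.passage c a).2,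
      ∃ s, L.curve (L.passage c a).1 t ∈ (L.chart c).toFun '' ray a s := by
  filter_upwards [nhdsWithin_le_nhds (L.eventually_near_passage c a), self_mem_nhdsWithin]
    with t ⟨h1, p, hp, he⟩ hne
  have hp0 : p ≠ (0, 0) := by
    rintro rfl
    rw [(L.chart c).map_zero] at he
    obtain ⟨b, hb⟩ := L.exists_eq_passage (c := c) (t := ⟨(L.passage c a).1, t⟩) he.symm
    by_cases hba : b = a
    · subst hba
      exact hne (congrArg (fun x : Σ _ : Fin L.n, Circle => x.2) hb)
    · have : b = !a := by cases a <;> cases b <;> simp_all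
      exact h1 (this ▸ hb)
  obtain ⟨s, hs⟩ := exists_mem_ray_of_mem_axis hp hp0
  exact ⟨s, p, hs, he⟩

/-- A curve passing through a crossing goes from one half-axis to the opposite one. -/
theorem exists_sides (c : crossingSet L.curve) (a : Bool) {s : ℝ}
    (hs : Circle.exp s = (L.passage c a).2) : ∃ b,
      (∀ᶠ s' in 𝓝[<] s,
        L.curve (L.passage c a).1 (Circle.exp s') ∈ (L.chart c).toFun '' ray a b) ∧
      (∀ᶠ s' in 𝓝[>] s,
        L.curve (L.passage c a).1 (Circle.exp s') ∈ (L.chart c).toFun '' ray a !b) := by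
  set i := (L.passage c a).1
  have hnear : ∀ᶠ s' in 𝓝 s,
      (⟨i, Circle.exp s'⟩ : Σ _ : Fin L.n, Circle) ≠ L.passage c !a ∧
      L.curve i (Circle.exp s') ∈ (L.chart c).toFun '' axis a := by
    have h := L.eventually_near_passage c a
    rw [← hs] at h
    exact Circle.exp.continuous.continuousAt.eventually h
  obtain ⟨ε, hε, hball⟩ := Metric.eventually_nhds_iff.1 hnear
  -- The bound by `π` makes `Circle.exp` injective on the open interval of radius `δ`.
  set δ := min ε Real.pi
  have hδ : 0 < δ := lt_min hε Real.pi_pos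
  have hgood : ∀ s' ∈ Ioo (s - δ) (s + δ),
      (⟨i, Circle.exp s'⟩ : Σ _ : Fin L.n, Circle) ≠ L.passage c !a ∧
      L.curve i (Circle.exp s') ∈ (L.chart c).toFun '' axis a := by
    intro s' hs'
    refine hball ?_
    rw [Real.dist_eq, abs_lt]
    have := min_le_left ε Real.pi
    constructor <;> linarith [hs'.1, hs'.2]
  let e := (L.chart c).isOpenEmbedding.toOpenPartialHomeomorph
  let x : ℝ → ℝ := fun s' => coord a (e.symm (L.curve i (Circle.exp s')))
  have hsymm : ∀ p, e.symm ((L.chart c).toFun p) = p := fun p => e.left_inv (mem_univ p)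
  have hx : ∀ s' ∈ Ioo (s - δ) (s + δ), ∃ p ∈ axis a,
      (L.chart c).toFun p = L.curve i (Circle.exp s') ∧ coord a p = x s' := by
    intro s' hs'
    obtain ⟨-, p, hp, he⟩ := hgood s' hs'
    exact ⟨p, hp, he, by simp only [x]; rw [← he, hsymm]⟩
  have hcont : ContinuousOn x (Ioo (s - δ) (s + δ)) := by
    refine (continuous_coord a).comp_continuousOn (e.symm.continuousOn.comp
      ((L.curve i).continuous.comp Circle.exp.continuous).continuousOn ?_)
    intro s' hs'
    obtain ⟨p, -, he, -⟩ := hx s' hs'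
    change L.curve i (Circle.exp s') ∈ e.target
    rw [← he]
    exact e.map_source (mem_univ p)
  -- Equal coordinates at distinct points of the circle would give a crossing in this chart. By
  -- disjointness of the charts it is `c`, but near `s` the curve meets `c` only in the passage `a`.
  have hinj : InjOn x (Ioo (s - δ) (s + δ)) := by
    intro s₁ h₁ s₂ h₂ h12
    obtain ⟨p, hp, hpe, hpx⟩ := hx s₁ h₁
    obtain ⟨q, hq, hqe, hqx⟩ := hx s₂ h₂
    have hpq : p = q := eq_of_coord_eq hp hq (by rw [hpx, hqx, h12])
    have hexp : Circle.exp s₁ = Circle.exp s₂ := by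
      by_contra hne
      have hcr : (L.chart c).toFun p ∈ crossingSet L.curve :=
        ⟨⟨i, Circle.exp s₁⟩, ⟨i, Circle.exp s₂⟩, fun h => hne (by simpa using h), hpe.symm,
          by rw [hpq]; exact hqe.symm⟩
      have h0 : (L.chart ⟨_, hcr⟩).toFun (0, 0) = (L.chart c).toFun p :=
        (L.chart ⟨_, hcr⟩).map_zero
      obtain ⟨-, rfl⟩ := L.eq_of_chart_eq_chart h0
      rw [(L.chart c).map_zero] at hpe
      rw [← hpq, (L.chart c).map_zero] at hqe
      have only : ∀ s' ∈ Ioo (s - δ) (s + δ), (c : X) = L.curve i (Circle.exp s') →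
          (⟨i, Circle.exp s'⟩ : Σ _ : Fin L.n, Circle) = L.passage c a := by
        intro s' hs' he
        obtain ⟨b, hb⟩ := L.exists_eq_passage (c := c) (t := ⟨i, Circle.exp s'⟩) he.symm
        by_cases hba : b = a
        · exact hba ▸ hb
        · have : b = !a := by cases a <;> cases b <;> simp_all
          exact absurd (this ▸ hb) (hgood s' hs').1
      have := (only s₁ h₁ hpe).trans (only s₂ h₂ hqe).symm
      exact hne (congrArg (fun x : Σ _ : Fin L.n, Circle => x.2) this)
    have hδpi : δ ≤ Real.pi := min_le_right _ _
    rcases le_total s₁ s₂ with hle | hle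
    · exact Circle.exp_injOn_Icc (a := s₁) (b := s₂) (by linarith [h₁.1, h₂.2]) ⟨le_rfl, hle⟩
        ⟨hle, le_rfl⟩ hexp
    · exact Circle.exp_injOn_Icc (a := s₂) (b := s₁) (by linarith [h₂.1, h₁.2]) ⟨hle, le_rfl⟩
        ⟨le_rfl, hle⟩ hexp
  have hsmem : s ∈ Ioo (s - δ) (s + δ) := ⟨by linarith, by linarith⟩
  have hx0 : x s = 0 := by
    simp only [x]
    have : L.curve i (Circle.exp s) = (L.chart c).toFun (0, 0) := by
      rw [(L.chart c).map_zero, hs]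
      exact L.totalMap_passage c a
    rw [this, hsymm, coord_zero]
  have hleft : ∀ᶠ s' in 𝓝[<] s, s' < s ∧ s' ∈ Ioo (s - δ) (s + δ) := by
    filter_upwards [self_mem_nhdsWithin,
      nhdsWithin_le_nhds (isOpen_Ioo.mem_nhds hsmem)] with s' h1 h2 using ⟨h1, h2⟩
  have hright : ∀ᶠ s' in 𝓝[>] s, s < s' ∧ s' ∈ Ioo (s - δ) (s + δ) := by
    filter_upwards [self_mem_nhdsWithin,
      nhdsWithin_le_nhds (isOpen_Ioo.mem_nhds hsmem)] with s' h1 h2 using ⟨h1, h2⟩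
  have hneg : ∀ s' ∈ Ioo (s - δ) (s + δ), x s' < 0 →
      L.curve i (Circle.exp s') ∈ (L.chart c).toFun '' ray a false := by
    intro s' hs' h
    obtain ⟨p, hp, he, hc⟩ := hx s' hs'
    exact ⟨p, ⟨hp, by simp [sgn, hc, h]⟩, he⟩
  have hpos : ∀ s' ∈ Ioo (s - δ) (s + δ), 0 < x s' →
      L.curve i (Circle.exp s') ∈ (L.chart c).toFun '' ray a true := by
    intro s' hs' h
    obtain ⟨p, hp, he, hc⟩ := hx s' hs'
    exact ⟨p, ⟨hp, by simp [sgn, hc, h]⟩, he⟩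
  -- A continuous injective function on an interval is strictly monotone; since it vanishes at `s`,
  -- it changes sign there.
  rcases hcont.strictMonoOn_of_injOn_Ioo (by linarith) hinj with hm | hm
  · refine ⟨false, ?_, ?_⟩
    · filter_upwards [hleft] with s' h
      exact hneg s' h.2 (hx0 ▸ hm h.2 hsmem h.1)
    · filter_upwards [hright] with s' h
      exact hpos s' h.2 (hx0 ▸ hm hsmem h.2 h.1)
  · refine ⟨true, ?_, ?_⟩
    · filter_upwards [hleft] with s' h
      exact hpos s' h.2 (hx0 ▸ hm h.2 hsmem h.1)
    · filter_upwards [hright] with s' h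
      exact hneg s' h.2 (hx0 ▸ hm hsmem h.2 h.1)

/-! ### Jumps of locally constant functions on the core -/

theorem finite_passage_params (i : Fin L.n) : {t | L.curve i t ∈ crossingSet L.curve}.Finite := by
  refine (Set.finite_range fun x : crossingSet L.curve × Bool => (L.passage x.1 x.2).2).subset ?_
  intro t ht
  obtain ⟨c, a, h⟩ := (L.mem_crossingSet_iff (t := ⟨i, t⟩)).1 ht
  exact ⟨(c, a), by simp only; rw [← h]⟩

theorem notMem_crossingSet_of_mem_core {x : X} (hx : x ∈ L.core) : x ∉ crossingSet L.curve := by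
  intro hc
  have h0 := (L.chart ⟨x, hc⟩).map_zero
  have : (L.chart ⟨x, hc⟩).toFun (0, 0) ∈ L.core := h0.symm ▸ hx
  have := (L.chart_mem_core_iff.1 this).2
  norm_num at this

variable [T2Space X]

theorem eventually_apply_retract_curve (h : LocallyConstant L.core (ZMod 2)) {i : Fin L.n}
    {t : Circle} (ht : L.curve i t ∉ crossingSet L.curve) :
    ∀ᶠ t' in 𝓝 t, h (L.retract (L.curve i t')) = h (L.retract (L.curve i t)) := by
  have hmem : ∀ t, L.curve i t ∈ L.carrier univ := fun t => by
    rw [carrier_univ]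
    exact ⟨⟨i, t⟩, rfl⟩
  have htend : Tendsto (L.curve i) (𝓝 t) (𝓝[L.carrier univ] (L.curve i t)) :=
    tendsto_nhdsWithin_iff.2 ⟨(L.curve i).continuous.continuousAt, Eventually.of_forall hmem⟩
  exact htend.eventually (L.eventually_apply_retract h (hmem t) ht)

/-- Along curve `i`, the composite of `h` with the retraction is locally constant except at
passages, where it goes from one corner value to the opposite one. -/
theorem sum_jumps_eq_zero [Fintype (crossingSet L.curve)] (i : Fin L.n)
    (h : LocallyConstant L.core (ZMod 2)) :
    ∑ x : crossingSet L.curve × Bool, (if (L.passage x.1 x.2).1 = i then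
      h (L.corner x.1 x.2 true) + h (L.corner x.1 x.2 false) else 0) = 0 := by
  classical
  rw [← Finset.sum_filter, ← Finset.sum_subtype_eq_sum_filter, Finset.subtype_univ]
  refine sum_jumps_circle_eq_zero
    (fun x : {x : crossingSet L.curve × Bool // (L.passage x.1 x.2).1 = i} =>
      (L.passage x.1.1 x.1.2).2) ?_ (fun t => h (L.retract (L.curve i t))) _ ?_ ?_
  · rintro ⟨⟨c, a⟩, rfl⟩ ⟨⟨d, b⟩, hd⟩ he
    obtain ⟨rfl, rfl⟩ := L.passage_injective (Sigma.ext hd.symm (heq_of_eq he))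
    rfl
  · intro t ht
    refine L.eventually_apply_retract_curve h fun hc => ht ?_
    obtain ⟨c, a, hca⟩ := (L.mem_crossingSet_iff (t := ⟨i, t⟩)).1 hc
    exact ⟨⟨(c, a), by rw [← hca]⟩, by simp only; rw [← hca]⟩
  · rintro ⟨⟨c, a⟩, rfl⟩ s hs
    obtain ⟨b, hl, hr⟩ := L.exists_sides c a hs
    refine ⟨h (L.corner c a b), h (L.corner c a !b), ?_, ?_, ?_⟩
    · cases b
      · exact add_comm _ _
      · rfl
    · filter_upwards [hl] with s' hs' using L.apply_retract_of_mem_ray h hs'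
    · filter_upwards [hr] with s' hs' using L.apply_retract_of_mem_ray h hs'

/-- A point of the core on the given curve, up to an arc avoiding the crossings. -/
def basePt (i : Fin L.n) : L.core :=
  L.retract (L.curve i (L.finite_passage_params i).exists_notMem.choose)

/-- Locally constant functions without jumps are constant along the curves. -/
theorem apply_eq_apply_basePt {h : LocallyConstant L.core (ZMod 2)}
    (h0 : ∀ c a, h (L.corner c a true) + h (L.corner c a false) = 0) (i : Fin L.n) :
    ∀ t, ∀ᶠ t' in 𝓝[≠] t, h (L.retract (L.curve i t')) = h (L.basePt i) := by
  have heq : ∀ c a s, h (L.corner c a s) = h (L.corner c a true) := by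
    intro c a s
    cases s
    · exact (CharTwo.add_eq_zero.1 (h0 c a)).symm
    · rfl
  obtain ⟨w, hw⟩ := (isPreconnected_univ (α := Circle)).exists_eventually_punctured_eq
    (F := fun t => h (L.retract (L.curve i t))) (by
      intro t _
      by_cases ht : L.curve i t ∈ crossingSet L.curve
      · obtain ⟨c, a, hca⟩ := (L.mem_crossingSet_iff (t := ⟨i, t⟩)).1 ht
        obtain rfl : i = (L.passage c a).1 := by rw [← hca]
        obtain rfl : t = (L.passage c a).2 := by rw [← hca]
        refine ⟨h (L.corner c a true), ?_⟩
        filter_upwards [L.eventually_punctured_mem_ray c a] with t' ⟨s, hs⟩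
        rw [L.apply_retract_of_mem_ray h hs, heq]
      · exact ⟨_, nhdsWithin_le_nhds (L.eventually_apply_retract_curve h ht)⟩)
  have hbase := (L.finite_passage_params i).exists_notMem.choose_spec
  obtain ⟨t', e1, e2⟩ := ((hw _ (mem_univ _)).and
    (nhdsWithin_le_nhds (L.eventually_apply_retract_curve h hbase))).exists
  have hw' : w = h (L.basePt i) := e1.symm.trans e2
  exact fun t => hw' ▸ hw t (mem_univ t)

theorem corner_eq_apply_basePt {h : LocallyConstant L.core (ZMod 2)}
    (h0 : ∀ c a, h (L.corner c a true) + h (L.corner c a false) = 0)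
    (c : crossingSet L.curve) (a : Bool) :
    h (L.corner c a true) = h (L.basePt (L.passage c a).1) := by
  obtain ⟨t, ⟨s, hs⟩, e⟩ := ((L.eventually_punctured_mem_ray c a).and
    (L.apply_eq_apply_basePt h0 _ _)).exists
  rw [← e, L.apply_retract_of_mem_ray h hs]
  cases s
  · exact CharTwo.add_eq_zero.1 (h0 c a)
  · rfl

/-- Without jumps, `h` is constant along every curve, hence determined by its values at the base
points. -/
theorem eq_zero_of_jumps_eq_zero {h : LocallyConstant L.core (ZMod 2)}
    (hb : ∀ i, h (L.basePt i) = 0)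
    (h0 : ∀ c a, h (L.corner c a true) + h (L.corner c a false) = 0) : h = 0 := by
  ext ⟨x, hx⟩
  obtain ⟨⟨i, t⟩, hit⟩ : x ∈ range (totalMap L.curve) := by
    rw [← carrier_univ]
    exact L.core_subset_carrier hx
  have hit : L.curve i t = x := hit
  have hc : L.curve i t ∉ crossingSet L.curve := hit ▸ L.notMem_crossingSet_of_mem_core hx
  obtain ⟨t', e1, e2⟩ := ((L.apply_eq_apply_basePt h0 i t).and
    (nhdsWithin_le_nhds (L.eventually_apply_retract_curve h hc))).exists
  rw [e2, hit, L.retract_of_mem_core hx] at e1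
  rw [e1, hb]
  rfl

instance finite_locallyConstant_core : Finite (LocallyConstant L.core (ZMod 2)) := by
  let Φ : LocallyConstant L.core (ZMod 2) →+ (Fin L.n → ZMod 2) ×
      (crossingSet L.curve → Bool → ZMod 2) :=
    { toFun := fun h => (fun i => h (L.basePt i),
        fun c a => h (L.corner c a true) + h (L.corner c a false))
      map_zero' := by ext <;> simp
      map_add' := fun f g => by
        refine Prod.ext rfl ?_
        funext c a
        exact add_add_add_comm _ _ _ _ }
  refine Finite.of_injective Φ ((injective_iff_map_eq_zero Φ).2 fun h hh => ?_)
  exact L.eq_zero_of_jumps_eq_zero (fun i => congrFun (congrArg Prod.fst hh) i)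
    fun c a => congrFun (congrFun (congrArg Prod.snd hh) c) a

end DottedLink

end

noncomputable section

open Module

namespace DottedLink

open Cross

variable {X : Type*} [TopologicalSpace X] (L : DottedLink X)

/-! ### Split components -/

/-- Two curves of a link that meet. -/
def Meets (i j : Fin L.n) : Prop := ¬ Disjoint (range (L.curve i)) (range (L.curve j))

/-- The curves that can be reached from the given one through curves that meet. -/
def cluster (i : Fin L.n) : Set (Fin L.n) := {j | Relation.ReflTransGen L.Meets i j}

theorem Meets.symm {i j : Fin L.n} (h : L.Meets i j) : L.Meets j i := fun h' => h h'.symm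

theorem disjoint_carrier_iff {S T : Set (Fin L.n)} :
    Disjoint (L.carrier S) (L.carrier T) ↔ ∀ i ∈ S, ∀ j ∈ T, ¬ L.Meets i j := by
  simp only [carrier, disjoint_iUnion_left, disjoint_iUnion_right, Meets, not_not]
  exact ⟨fun h i hi j hj => h j hj i hi, fun h j hj i hi => h i hi j hj⟩

theorem meets_self (i : Fin L.n) : L.Meets i i := by
  rw [Meets, disjoint_self]
  exact (range_nonempty _).ne_empty

theorem isSplitComponent_cluster (i : Fin L.n) : L.IsSplitComponent (L.cluster i) := by
  refine ⟨⟨i, Relation.ReflTransGen.refl⟩, ?_, ?_⟩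
  · rintro ⟨S₁, S₂, ⟨j₁, h₁⟩, ⟨j₂, h₂⟩, hS, hdisj⟩
    rw [disjoint_carrier_iff] at hdisj
    -- The piece containing `i` is closed under meeting and so contains the whole cluster. A member
    -- of the other piece then lies in both and meets itself.
    have hclosed : ∀ T₁ T₂ : Set (Fin L.n), T₁ ∪ T₂ = L.cluster i →
        (∀ k ∈ T₁, ∀ l ∈ T₂, ¬ L.Meets k l) → i ∈ T₁ → L.cluster i ⊆ T₁ := by
      intro T₁ T₂ hT hd hi j hj
      induction hj with
      | refl => exact hi
      | tail hjk hkl ih =>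
        have : _ ∈ T₁ ∪ T₂ := hT.symm ▸ (show _ ∈ L.cluster i from hjk.tail hkl)
        exact this.resolve_right fun h => hd _ ih _ h hkl
    have hi : i ∈ S₁ ∪ S₂ := hS ▸ (Relation.ReflTransGen.refl : i ∈ L.cluster i)
    rcases hi with hi | hi
    · have := hclosed S₁ S₂ hS hdisj hi (hS ▸ Or.inr h₂ : j₂ ∈ L.cluster i)
      exact hdisj _ this _ h₂ (L.meets_self _)
    · have := hclosed S₂ S₁ (by rw [union_comm, hS])
        (fun k hk l hl h => hdisj l hl k hk h.symm) hi (hS ▸ Or.inl h₁ : j₁ ∈ L.cluster i)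
      exact hdisj _ h₁ _ this (L.meets_self _)
  · rw [disjoint_carrier_iff]
    exact fun j hj k hk h => hk (Relation.ReflTransGen.tail hj h)

/-- A common point of two different curves is a crossing, and both curves occur among its two
passages. -/
theorem eq_of_meets {φ : Fin L.n → ZMod 2} (hφ : φ ∈ edgeConstant fun c a => (L.passage c a).1)
    {i j : Fin L.n} (h : L.Meets i j) : φ i = φ j := by
  rw [mem_edgeConstant] at hφ
  by_cases hij : i = j
  · rw [hij]
  · obtain ⟨x, ⟨t, ht⟩, ⟨u, hu⟩⟩ := Set.not_disjoint_iff.1 h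
    have hx : x ∈ crossingSet L.curve :=
      ⟨⟨i, t⟩, ⟨j, u⟩, fun h => hij (congrArg Sigma.fst h), ht, hu⟩
    have key : ∀ k v, totalMap L.curve ⟨k, v⟩ = x →
        φ k = φ (L.passage ⟨x, hx⟩ false).1 := by
      intro k v hk
      obtain ⟨a, ha⟩ := L.exists_eq_passage (c := ⟨x, hx⟩) hk
      have hk' : k = (L.passage ⟨x, hx⟩ a).1 := congrArg Sigma.fst ha
      rw [hk']
      cases a
      · rfl
      · exact (hφ _).symm
    rw [key i t ht, key j u hu]

/-- Every curve lies in a cluster, which is a split component on which `φ` is constant; thus one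
value per split component determines `φ`. -/
theorem finrank_edgeConstant_le_sc :
    finrank (ZMod 2) (edgeConstant fun c a => (L.passage c a).1) ≤ L.sc := by
  classical
  have : Fintype {S : Set (Fin L.n) | L.IsSplitComponent S} := Fintype.ofFinite _
  let Φ : (edgeConstant fun c a => (L.passage c a).1) →ₗ[ZMod 2]
      ({S : Set (Fin L.n) | L.IsSplitComponent S} → ZMod 2) :=
    (LinearMap.pi fun S => LinearMap.proj S.2.1.some) ∘ₗ Submodule.subtype _
  have hΦ : Function.Injective Φ := by
    rw [← LinearMap.ker_eq_bot, LinearMap.ker_eq_bot']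
    rintro ⟨φ, hφ⟩ h0
    refine Subtype.ext (funext fun i => ?_)
    have hS := L.isSplitComponent_cluster i
    have h1 : φ hS.1.some = 0 := congrFun h0 ⟨_, hS⟩
    have h2 : ∀ j ∈ L.cluster i, φ i = φ j := by
      intro j hj
      induction hj with
      | refl => rfl
      | tail _ hkl ih => exact ih.trans (L.eq_of_meets hφ hkl)
    exact (h2 _ hS.1.some_mem).trans h1
  have := LinearMap.finrank_le_finrank_of_injective hΦ
  rwa [finrank_fintype_fun_eq_card, ← Nat.card_eq_fintype_card, Nat.card_coe_set_eq] at this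

/-- A proper split component and its complement would split the link. -/
theorem sc_le_one_of_unsplittable (h : L.Unsplittable) : L.sc ≤ 1 := by
  have : {S : Set (Fin L.n) | L.IsSplitComponent S} ⊆ {univ} := by
    rintro S ⟨hne, -, hd⟩
    by_contra hS
    exact h ⟨S, Sᶜ, hne, nonempty_compl.2 hS, union_compl_self S, hd⟩
  exact (ncard_le_ncard this).trans (ncard_singleton _).le

/-! ### Locally constant functions on the smoothed links -/

open Classical in
/-- The smoothings at the crossings in the state `C`. -/
def state (C : Finset X) (c : crossingSet L.curve) : Bool := decide ((c : X) ∈ C)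

theorem smoothing_eq (C : Finset X) : L.smoothing C = L.core ∪
    ⋃ k : crossingSet L.curve × Bool, (L.chart k.1).toFun '' arc (L.state C k.1) k.2 := by
  rw [smoothing, core, iUnion_prod']
  simp only [smoothingArcs_eq, image_iUnion]
  congr! 7
  exact decide_eq_decide.2 Iff.rfl

theorem core_subset_smoothing (C : Finset X) : L.core ⊆ L.smoothing C := by
  rw [smoothing_eq]
  exact subset_union_left

theorem chart_image_arc_subset_smoothing (C : Finset X) (c : crossingSet L.curve) (s : Bool) :
    (L.chart c).toFun '' arc (L.state C c) s ⊆ L.smoothing C := by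
  rw [smoothing_eq]
  exact (subset_iUnion (fun k : crossingSet L.curve × Bool =>
    (L.chart k.1).toFun '' arc (L.state C k.1) k.2) (c, s)).trans subset_union_right

/-- Evaluation at the ends of the core. -/
def evalCorner (c : crossingSet L.curve) (a s : Bool) :
    LocallyConstant L.core (ZMod 2) →ₗ[ZMod 2] ZMod 2 :=
  LocallyConstant.evalₗ (ZMod 2) (L.corner c a s)

/-- Restriction of locally constant functions from a smoothed link to the core. -/
def restrictCore (C : Finset X) :
    LocallyConstant (L.smoothing C) (ZMod 2) →ₗ[ZMod 2] LocallyConstant L.core (ZMod 2) :=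
  LocallyConstant.comapₗ (ZMod 2)
    ⟨inclusion (L.core_subset_smoothing C), continuous_inclusion _⟩

theorem apply_eq_of_mem_arc {C : Finset X} (f : LocallyConstant (L.smoothing C) (ZMod 2))
    (c : crossingSet L.curve) (s : Bool) {p q : ℝ × ℝ} (hp : p ∈ arc (L.state C c) s)
    (hq : q ∈ arc (L.state C c) s) :
    f ⟨_, L.chart_image_arc_subset_smoothing C c s (mem_image_of_mem _ hp)⟩ =
      f ⟨_, L.chart_image_arc_subset_smoothing C c s (mem_image_of_mem _ hq)⟩ := by
  let g : arc (L.state C c) s → L.smoothing C := fun q =>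
    ⟨_, L.chart_image_arc_subset_smoothing C c s (mem_image_of_mem _ q.2)⟩
  have hg : Continuous g :=
    ((L.chart c).isOpenEmbedding.continuous.comp continuous_subtype_val).subtype_mk _
  have : PreconnectedSpace (arc (L.state C c) s) :=
    isPreconnected_iff_preconnectedSpace.1 (isPreconnected_arc _ s)
  exact (f.isLocallyConstant.comp_continuous hg).apply_eq_of_preconnectedSpace ⟨p, hp⟩ ⟨q, hq⟩

theorem restrictCore_mem_stateSpace {C : Finset X}
    (f : LocallyConstant (L.smoothing C) (ZMod 2)) :
    L.restrictCore C f ∈ stateSpace L.evalCorner (L.state C) := fun c s =>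
  L.apply_eq_of_mem_arc f c s (dir_false_mem_arc _ s) (dir_true_mem_arc _ s)

theorem restrictCore_injective (C : Finset X) : Function.Injective (L.restrictCore C) := by
  rw [← LinearMap.ker_eq_bot, LinearMap.ker_eq_bot']
  intro f hf
  have hcore : ∀ x (hx : x ∈ L.core), f ⟨x, L.core_subset_smoothing C hx⟩ = 0 := fun x hx =>
    congrArg (fun h : LocallyConstant L.core (ZMod 2) => h ⟨x, hx⟩) hf
  ext ⟨x, hx⟩
  have hx' := hx
  rw [smoothing_eq] at hx'
  rcases hx' with hx' | hx'
  · exact hcore x hx'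
  · obtain ⟨⟨c, s⟩, p, hp, rfl⟩ := mem_iUnion.1 hx'
    exact (L.apply_eq_of_mem_arc f c s hp (dir_false_mem_arc _ s)).trans
      (hcore _ (L.corner c false s).2)

variable [T2Space X]

/-- The function `h` is extended by constants over the arcs; continuity holds because the core and
the arcs form a finite closed cover. -/
theorem exists_restrictCore_eq {C : Finset X} {h : LocallyConstant L.core (ZMod 2)}
    (hh : h ∈ stateSpace L.evalCorner (L.state C)) : ∃ f, L.restrictCore C f = h := by
  classical
  let A : crossingSet L.curve × Bool → Set X := fun k =>
    (L.chart k.1).toFun '' arc (L.state C k.1) k.2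
  let F : X → ZMod 2 := fun x =>
    if hx : x ∈ L.core then h ⟨x, hx⟩
    else if hx : ∃ k, x ∈ A k then h (L.corner hx.choose.1 false hx.choose.2) else 0
  have hFcore : ∀ x (hx : x ∈ L.core), F x = h ⟨x, hx⟩ := fun x hx => dif_pos hx
  have hFarc : ∀ k, ∀ x ∈ A k, F x = h (L.corner k.1 false k.2) := by
    rintro ⟨c, s⟩ _ ⟨p, hp, rfl⟩
    by_cases hx : (L.chart c).toFun p ∈ L.core
    · rw [hFcore _ hx]
      -- An arc meets the core only at its two ends, where the values agree by the state condition.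
      rcases eq_dir_of_mem_arc hp (L.chart_mem_core_iff.1 hx).1 with rfl | rfl
      · rfl
      · exact (hh c s).symm
    · have hex : ∃ k, (L.chart c).toFun p ∈ A k := ⟨(c, s), p, hp, rfl⟩
      simp only [F]
      rw [dif_neg hx, dif_pos hex]
      obtain ⟨q, hq, he⟩ := hex.choose_spec
      obtain ⟨h1, rfl⟩ := L.eq_of_chart_eq_chart he
      rw [h1] at hq ⊢
      rw [arc_unique hq hp]
  let B : Option (crossingSet L.curve × Bool) → Set X := fun o => o.elim L.core A
  have hB : L.smoothing C = ⋃ o, B o := by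
    rw [smoothing_eq, iUnion_option]
    rfl
  have hcont : ContinuousOn F (L.smoothing C) := by
    rw [hB]
    refine (locallyFinite_of_finite B).continuousOn_iUnion ?_ ?_
    · rintro (_ | ⟨c, s⟩)
      · exact L.isClosed_core
      · exact L.isCompact_chart_image c (isCompact_arc _ s)
    · rintro (_ | k)
      · rw [continuousOn_iff_continuous_domRestrict]
        refine h.continuous.congr fun x => (hFcore x x.2).symm
      · exact continuousOn_const.congr (hFarc k)
  refine ⟨⟨fun x => F x, (IsLocallyConstant.iff_continuous _).2
    (continuousOn_iff_continuous_domRestrict.1 hcont)⟩, ?_⟩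
  ext x
  exact hFcore x x.2

instance finite_locallyConstant_smoothing (C : Finset X) :
    Finite (LocallyConstant (L.smoothing C) (ZMod 2)) :=
  Finite.of_injective _ (L.restrictCore_injective C)

/-- The number of loops of a state as a dimension. -/
theorem smoothingCount_eq_finrank (C : Finset X) :
    L.smoothingCount C = finrank (ZMod 2) (stateSpace L.evalCorner (L.state C)) := by
  rw [smoothingCount, ← finrank_locallyConstant,
    (LinearEquiv.ofInjective _ (L.restrictCore_injective C)).finrank_eq]
  have : LinearMap.range (L.restrictCore C) = stateSpace L.evalCorner (L.state C) := by
    ext h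
    constructor
    · rintro ⟨f, rfl⟩
      exact L.restrictCore_mem_stateSpace f
    · exact L.exists_restrictCore_eq
  rw [this]

theorem smoothingCount_pos (C : Finset X) : 1 ≤ L.smoothingCount C := by
  have : Nonempty (L.smoothing C) :=
    Nonempty.map (inclusion (L.core_subset_smoothing C)) L.nonempty_core
  -- Finiteness matters: `Nat.card` of an infinite type is zero.
  have := finite_connectedComponents_of_finite_locallyConstant (S := L.smoothing C)
  exact Nat.card_pos

theorem smoothingCount_le_of_eq_off {C D : Finset X} (c : crossingSet L.curve)
    (h : ∀ x, x ≠ (c : X) → (x ∈ C ↔ x ∈ D)) : L.smoothingCount C ≤ L.smoothingCount D + 1 := by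
  rw [smoothingCount_eq_finrank, smoothingCount_eq_finrank]
  refine finrank_stateSpace_le_of_eq_off _ c fun d hd => ?_
  have : (d : X) ≠ c := fun h => hd (Subtype.ext h)
  exact decide_eq_decide.2 (h d this)

/-- The numbers of loops in the two extreme states. -/
theorem smoothingCount_crossings_add_le :
    L.smoothingCount L.crossings + L.smoothingCount ∅ ≤ L.cro + 2 * L.sc := by
  have : Fintype (crossingSet L.curve) := Fintype.ofFinite _
  have h1 : L.state L.crossings = fun _ => true := by
    funext c
    simp [state, crossings]
  have h2 : L.state ∅ = fun _ => false := by
    funext c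
    simp [state]
  have h3 : L.cro = Fintype.card (crossingSet L.curve) := by
    rw [cro, crossings, ← ncard_eq_toFinset_card _ L.generic.finite_crossings,
      ← Nat.card_coe_set_eq, Nat.card_eq_fintype_card]
  -- The graph has the curves as vertices and joins, for each crossing, the curves of its two
  -- passages.
  have h4 := finrank_stateSpace_add_le L.evalCorner (fun c a => (L.passage c a).1)
    (fun i => LocallyConstant.evalₗ (ZMod 2) (L.basePt i))
    (fun h => L.eq_zero_of_jumps_eq_zero) L.sum_jumps_eq_zero
    (fun h => L.corner_eq_apply_basePt)
  rw [smoothingCount_eq_finrank, smoothingCount_eq_finrank, h1, h2, h3]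
  exact h4.trans (by have := L.finrank_edgeConstant_le_sc; omega)

/-- The state-sum bound and the estimate for the extreme states combine to
$2\operatorname{cro}+2(\operatorname{cro}+2\,sc)-4$. -/
theorem laurentSpan_bracket_le : laurentSpan L.bracket ≤ 4 * (L.cro : ℤ) + 4 * L.sc - 4 := by
  classical
  have key : ∀ C c, c ∈ L.crossings → c ∉ C →
      L.smoothingCount C ≤ L.smoothingCount (insert c C) + 1 ∧
      L.smoothingCount (insert c C) ≤ L.smoothingCount C + 1 := by
    intro C c hc hC
    have hc' : c ∈ crossingSet L.curve := by simpa [crossings] using hc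
    exact ⟨L.smoothingCount_le_of_eq_off ⟨c, hc'⟩ fun x hx => by simp [show x ≠ c from hx],
      L.smoothingCount_le_of_eq_off ⟨c, hc'⟩ fun x hx => by simp [show x ≠ c from hx]⟩
  have h1 := laurentSpan_stateSum_le L.crossings L.smoothingCount L.smoothingCount_pos
    (fun C c hc _ hC => (key C c hc hC).1) (fun C c hc _ hC => (key C c hc hC).2)
  have h2 := L.smoothingCount_crossings_add_le
  have h3 : L.crossings.card = L.cro := rfl
  rw [h3] at h1
  refine h1.trans ?_
  omega

end DottedLink

end

theorem theorem1 {X : Type*} [TopologicalSpace X] (hX : IsTwoComplex X) (L : DottedLink X) :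
    (L.cro : ℚ) ≥ 1 - (L.sc : ℚ) + (laurentSpan L.bracket : ℚ) / 4 ∧
      (L.Unsplittable → (L.cro : ℚ) ≥ (laurentSpan L.bracket : ℚ) / 4) := by
  have := hX.hausdorff
  have h : (laurentSpan L.bracket : ℚ) ≤ 4 * L.cro + 4 * L.sc - 4 := by
    exact_mod_cast L.laurentSpan_bracket_le
  refine ⟨by linarith, fun hL => ?_⟩
  have h1 : (L.sc : ℚ) ≤ 1 := by exact_mod_cast L.sc_le_one_of_unsplittable hL
  linarith
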